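/- Let $S$ be a smooth surface and let $D=\{c_1,\dots,c_n\}$ be an (ordered) star divisor on $S$, that is, a finite family of smooth closed curves in $S$ (closed subsets that are embedded one-dimensional submanifolds) which are pairwise transverse. The sections of the $b$-tangent bundle ${}^bTS$ of $(S,D)$ are the smooth vector fields tangent to every curve of $D$. A star log symplectic form is a smooth section $\omega$ of $\wedge^2({}^bT^*S)$ (a smooth $2$-form on $S\setminus D$ whose values on pairs of local $b$-vector fields extend smoothly over $D$) that is nondegenerate on ${}^bTS$ at every point of $S$; such a form is automatically closed. Let $p\in S$ be a point of degree $k\ge 2$, i.e. a point lying on exactly $k$ of the curves; renumber those curves $c_1,\dots,c_k$, keeping their order. Let $(U_0,(x,y))$ be any star chart centered at $p$: a smooth chart with $p=(0,0)$ in which $c_1=\{x=0\}$, $c_2=\{y=0\}$ and $c_i=\{A_ix+B_iy=0\}$ for $3\le i\le k$, with $A_i,B_i\in\mathbb{R}$. Then there are an open neighborhood $U\subseteq U_0$ of $p$, real numbers $c\neq 0$ and $\lambda_i,\delta_i$ $(3\le i\le k)$, $\nu_{ij}$ $(3\le i<j\le k)$, and a $b$-symplectomorphism $\Psi$ from $U$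 onto an open neighborhood of $p$ in $S$ (a diffeomorphism onto its image with $\Psi(p)=p$ that maps each curve of $D$ to itself, i.e. $q\in c_i\iff\Psi(q)\in c_i$ for $q\in U$) such that on $U$ $$\Psi^*\omega=\Big(\frac{c}{xy\prod_{i=3}^k(A_ix+B_iy)}+P\Big)\,dx\wedge dy,$$ $$P=\sum_{i=3}^k\Big(\frac{\lambda_i}{x(A_ix+B_iy)}+\frac{\delta_i}{y(A_ix+B_iy)}\Big)+\sum_{3\le i<j\le k}\frac{\nu_{ij}}{(A_ix+B_iy)(A_jx+B_jy)}.$$ Moreover, if $k\ge 3$ one can take $c\in\{1,-1\}$, and $c=1$ if in addition $k$ is odd. (For even $k\ge 4$ the sign can be absorbed by replacing one pair $(A_i,B_i)$ by $(-A_i,-B_i)$. For $k=2$ one has $P=0$.) -/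

import Mathlib

open scoped Manifold ContDiff

noncomputable section

namespace StarLog

/-- The model plane `ℝ²` with coordinates `x = v 0` and `y = v 1`. -/
abbrev Plane : Type := EuclideanSpace ℝ (Fin 2)

/-- The exterior product `a ∧ b` of two covectors:
`(a ∧ b)(v, w) = a(v) b(w) - a(w) b(v)`. -/
def wedge {V : Type*} [AddCommGroup V] [Module ℝ V] [TopologicalSpace V]
    (a b : V →L[ℝ] ℝ) : V [⋀^Fin 2]→L[ℝ] ℝ where
  toFun v := a (v 0) * b (v 1) - a (v 1) * b (v 0)
  map_update_add' := by
    intro inst v i x y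
    rw [Subsingleton.elim inst (instDecidableEqFin 2)]
    fin_cases i <;> simp <;> ring
  map_update_smul' := by
    intro inst v i c x
    rw [Subsingleton.elim inst (instDecidableEqFin 2)]
    fin_cases i <;> simp <;> ring
  map_eq_zero_of_eq' := by
    intro v i j h hij
    fin_cases i <;> fin_cases j <;> simp_all
  cont := by fun_prop

section Surface

variable {S : Type*} [TopologicalSpace S] [ChartedSpace Plane S]

/-- On the open set `U`, the smooth function `f` is a defining function of `c`: inside `U` the set
`c` is the zero set of `f`, and `df ≠ 0` along `c`. -/
structure IsDefiningFunctionOn (c U : Set S) (f : S → ℝ) : Prop where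
  isOpen : IsOpen U
  contMDiffOn : ContMDiffOn (𝓡 2) 𝓘(ℝ, ℝ) ∞ f U
  mem_iff : ∀ q ∈ U, q ∈ c ↔ f q = 0
  mfderiv_ne_zero : ∀ q ∈ U, q ∈ c → mfderiv (𝓡 2) 𝓘(ℝ, ℝ) f q ≠ 0

/-- A smooth closed curve in the surface `S`: a closed subset that is an embedded smooth
one-dimensional submanifold, i.e. locally has a defining function. -/
def IsSmoothClosedCurve (c : Set S) : Prop :=
  IsClosed c ∧ ∀ q ∈ c, ∃ (U : Set S) (f : S → ℝ), q ∈ U ∧ IsDefiningFunctionOn c U f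

/-- The tangent line `T_q c ⊆ T_q S` of a smooth curve `c` at a point `q ∈ c`: the kernel of the
differential of a local defining function (all of them have the same kernel). -/
def tangentLine (c : Set S) (q : S) : Submodule ℝ (TangentSpace (𝓡 2) q) where
  carrier := {v | ∀ (U : Set S) (f : S → ℝ), q ∈ U → IsDefiningFunctionOn c U f →
    mfderiv (𝓡 2) 𝓘(ℝ, ℝ) f q v = 0}
  zero_mem' := fun U f _ _ => map_zero _
  add_mem' := fun hv hw U f hq hf => by rw [map_add, hv U f hq hf, hw U f hq hf, add_zero]
  smul_mem' := fun r v hv U f hq hf => by rw [map_smul, hv U f hq hf, smul_zero]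

variable (S) in
/-- An (ordered) star divisor on `S`: a finite family of smooth closed curves which are pairwise
transverse. -/
structure StarDivisor (n : ℕ) where
  curve : Fin n → Set S
  isCurve : ∀ i, IsSmoothClosedCurve (curve i)
  transverse : ∀ i j, i ≠ j → ∀ q, q ∈ curve i → q ∈ curve j →
    tangentLine (curve i) q ⊔ tangentLine (curve j) q = ⊤

variable {n : ℕ}

/-- The union of the curves of the divisor. -/
def StarDivisor.support (D : StarDivisor S n) : Set S := ⋃ i, D.curve i

/-- The degree of a point: the number of curves of `D` that contain it. -/
def StarDivisor.degree (D : StarDivisor S n) (p : S) : ℕ := Set.ncard {i | p ∈ D.curve i}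

/-- A star chart centered at the intersection point `p`: a smooth chart `(U, (x, y))` in which the
two curves `α < β` of smallest index through `p` are `{x = 0}` and `{y = 0}`, and every curve
`ℓ` through `p` is a line `{A ℓ * x + B ℓ * y = 0}`. The coefficients are part of the data. -/
structure StarChart (D : StarDivisor S n) (p : S) where
  chart : OpenPartialHomeomorph S Plane
  mem_atlas : chart ∈ IsManifold.maximalAtlas (𝓡 2) ∞ S
  mem_source : p ∈ chart.source
  centered : chart p = 0
  α : Fin n
  β : Fin n
  α_mem : p ∈ D.curve α
  β_mem : p ∈ D.curve β
  α_lt_β : α < β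
  smallest : ∀ i, p ∈ D.curve i → i = α ∨ β ≤ i
  curve_α : ∀ q ∈ chart.source, q ∈ D.curve α ↔ chart q 0 = 0
  curve_β : ∀ q ∈ chart.source, q ∈ D.curve β ↔ chart q 1 = 0
  A : Fin n → ℝ
  B : Fin n → ℝ
  curve_line : ∀ i, p ∈ D.curve i → ∀ q ∈ chart.source,
    (q ∈ D.curve i ↔ A i * chart q 0 + B i * chart q 1 = 0)

/-- A `b`-vector field on the open set `U`: a smooth vector field on `U` which is tangent to every
curve of `D`. These are the sections over `U` of the `b`-tangent bundle of `(S, D)`. -/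
structure IsBVectorFieldOn [IsManifold (𝓡 2) ∞ S] (D : StarDivisor S n) (U : Set S)
    (X : ∀ q : S, TangentSpace (𝓡 2) q) : Prop where
  contMDiffOn : ContMDiffOn (𝓡 2) (𝓡 2).tangent ∞
    (fun q => (⟨q, X q⟩ : TangentBundle (𝓡 2) S)) U
  tangent : ∀ q ∈ U, ∀ i, q ∈ D.curve i → X q ∈ tangentLine (D.curve i) q

variable (S) in
/-- Pointwise alternating 2-forms on the tangent spaces of `S`, without any smoothness. Singular
forms along a divisor are such families whose values on the divisor are ignored. -/
abbrev TwoForm : Type _ := ∀ q : S, (TangentSpace (𝓡 2) q) [⋀^Fin 2]→L[ℝ] ℝ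

/-- The smooth function `g` on `U` is the value `Ω(X, Y)` of the `b`-form `Ω` on the `b`-fields
`X, Y`, i.e. it extends smoothly over the divisor the function `Ω(X, Y)`. -/
def IsPairingOn (D : StarDivisor S n) (Ω : TwoForm S) (U : Set S)
    (X Y : ∀ q : S, TangentSpace (𝓡 2) q) (g : S → ℝ) : Prop :=
  ContMDiffOn (𝓡 2) 𝓘(ℝ, ℝ) ∞ g U ∧ ∀ q ∈ U, q ∉ D.support → Ω q ![X q, Y q] = g q

/-- `Ω` is a smooth section of the second exterior power of the `b`-cotangent bundle: the pairing
of `Ω` with any two local `b`-vector fields is (extends over the divisor to) a smooth function.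
Away from the divisor every vector field is a `b`-field, so there this is ordinary smoothness; as
the complement of the divisor is dense, a `b`-form is determined by its values there. -/
def IsBTwoForm [IsManifold (𝓡 2) ∞ S] (D : StarDivisor S n) (Ω : TwoForm S) : Prop :=
  ∀ U : Set S, IsOpen U → ∀ X Y : (∀ q : S, TangentSpace (𝓡 2) q),
    IsBVectorFieldOn D U X → IsBVectorFieldOn D U Y → ∃ g : S → ℝ, IsPairingOn D Ω U X Y g

/-- A star log symplectic form: a `b`-form of degree two which is nondegenerate at every point of
`S` as a form on the `b`-tangent bundle, i.e. takes a nonzero value on some pair of `b`-vectors of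
that point. It is automatically closed, since the `b`-tangent bundle has rank two and so has no
nonzero 3-forms. -/
structure IsStarLogSymplectic [IsManifold (𝓡 2) ∞ S] (D : StarDivisor S n) (Ω : TwoForm S) :
    Prop where
  isBTwoForm : IsBTwoForm D Ω
  nondegenerate : ∀ q : S, ∃ (U : Set S) (X Y : ∀ q : S, TangentSpace (𝓡 2) q) (g : S → ℝ),
    IsOpen U ∧ q ∈ U ∧ IsBVectorFieldOn D U X ∧ IsBVectorFieldOn D U Y ∧
      IsPairingOn D Ω U X Y g ∧ g q ≠ 0

/-- `Ψ` is a `b`-symplectomorphism from `(U, Ω₀)` to `(Ψ(U), Ω)`, where `U = Ψ.source`: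
a diffeomorphism between open subsets of `S` that maps each curve of `D` to itself and satisfies
`Ψ^* Ω = Ω₀` (off the divisor, hence as `b`-forms). -/
structure IsBSymplectomorphism (D : StarDivisor S n) (Ω₀ Ω : TwoForm S)
    (Ψ : OpenPartialHomeomorph S S) : Prop where
  contMDiffOn : ContMDiffOn (𝓡 2) (𝓡 2) ∞ Ψ Ψ.source
  contMDiffOn_symm : ContMDiffOn (𝓡 2) (𝓡 2) ∞ Ψ.symm Ψ.target
  mem_curve_iff : ∀ i, ∀ q ∈ Ψ.source, Ψ q ∈ D.curve i ↔ q ∈ D.curve i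
  pullback_eq : ∀ q ∈ Ψ.source, q ∉ D.support →
    (Ω (Ψ q)).compContinuousLinearMap (mfderiv (𝓡 2) (𝓡 2) Ψ q) = Ω₀ q

namespace StarChart

variable {D : StarDivisor S n} {p : S}

/-- The coordinate function `x` of the star chart. -/
def x (χ : StarChart D p) (q : S) : ℝ := χ.chart q 0

/-- The coordinate function `y` of the star chart. -/
def y (χ : StarChart D p) (q : S) : ℝ := χ.chart q 1

/-- The linear function `A i * x + B i * y` defining the `i`-th curve through `p`. -/
def line (χ : StarChart D p) (i : Fin n) (q : S) : ℝ := χ.A i * χ.x q + χ.B i * χ.y q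

open Classical in
/-- The (indices of the) curves through `p` other than `{x = 0}` and `{y = 0}`. -/
def others (χ : StarChart D p) : Finset (Fin n) :=
  {i : Fin n | p ∈ D.curve i ∧ i ≠ χ.α ∧ i ≠ χ.β}

/-- The 2-form `dx ∧ dy` of the star chart. -/
def dxdy (χ : StarChart D p) : TwoForm S := fun q =>
  wedge (V := TangentSpace (𝓡 2) q)
    (mfderiv (𝓡 2) 𝓘(ℝ, ℝ) χ.x q) (mfderiv (𝓡 2) 𝓘(ℝ, ℝ) χ.y q)

/-- The function
`P = ∑ i, (lam i / (x L_i) + del i / (y L_i)) + ∑ i < j, nu i j / (L_i L_j)`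
with `L_i = A i * x + B i * y`, the indices running over the curves through `p` other than
`{x = 0}` and `{y = 0}`. -/
def polePart (χ : StarChart D p) (lam del : Fin n → ℝ) (nu : Fin n → Fin n → ℝ) (q : S) : ℝ :=
  ∑ i ∈ χ.others, (lam i / (χ.x q * χ.line i q) + del i / (χ.y q * χ.line i q))
    + ∑ i ∈ χ.others, ∑ j ∈ χ.others with i < j, nu i j / (χ.line i q * χ.line j q)

/-- The normal form `(c / (x y ∏ L_i) + P) dx ∧ dy`. -/
def normalForm (χ : StarChart D p) (c : ℝ) (lam del : Fin n → ℝ) (nu : Fin n → Fin n → ℝ) :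
    TwoForm S := fun q =>
  (c / (χ.x q * χ.y q * ∏ i ∈ χ.others, χ.line i q) + χ.polePart lam del nu q) • χ.dxdy q

end StarChart

end Surface

end StarLog

end

/-! Let m = k - 2, let Q be the product of the k linear forms of the curves through p, and let E be
the Euler field of the chart. Both E and a vertical field with determinant Q against E are b-fields,
so pairing them with Ω gives Ω = (F/Q) dx∧dy with F smooth (`exists_coefficient`,
`exists_local_form`). The determinant of any two b-fields is divisible by Q near p
(`exists_planeDet_eq`), so nondegeneracy forces F(0) ≠ 0 (`coefficient_ne_zero`).

The diffeomorphism is sought in the radial form z ↦ ρ(z) z, which preserves every line through the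
origin. Its Jacobian is ρ (ρ + Eρ), and Q(ρz) = ρ^(m+2) Q(z). Hence the pulled back form is ((c +
h)/Q) dx∧dy exactly when (ρ + Eρ) F(ρz) = (c + h) ρ^(m+1).

This equation is solved without a flow. The operator E - m kills homogeneous polynomials of degree
m, and modulo these it is onto the smooth functions: (E - m) A = F - h (`exists_radial_primitive`).
For Φ(z, r) = A(rz) r^(-m) + h(z) log r one computes that, along r = ρ(z), EΦ = (ρ + Eρ) F(ρz)
ρ^(-m-1) - h + mΦ. So any ρ on which Φ is constant works, with c = -mΦ, and the implicit function
theorem provides it since ∂Φ/∂r ≠ 0 at the origin (`exists_radial_scaling`). For m > 0 this gives c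
= F(0)/ρ(0)^m, and the free value ρ(0) normalises c to ±1, or to 1 when m is odd.

Finally h/Q, of degree m over m + 2 independent linear forms, splits into the terms of P; the term
1/(xy) is absorbed by the others when k ≥ 3 (`exists_partialFractions_coord`). When k = 2, c
vanishes and h is the constant F(0). -/

set_option linter.unusedSectionVars false

/-! ### Smooth calculus: parameter integrals, division by a linear form, cutoffs, inverse functions
-/

section Analysis

open MeasureTheory Set Filter Topology

variable {E F : Type} [NormedAddCommGroup E] [NormedSpace ℝ E] [FiniteDimensional ℝ E]
  [NormedAddCommGroup F] [NormedSpace ℝ F] [CompleteSpace F]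

/-- Differentiation under the integral sign of a `C¹` function over `[0, 1]`. -/
theorem hasFDerivAt_integral_unitInterval {f : E × ℝ → F} (hf : ContDiff ℝ 1 f) (z : E) :
    HasFDerivAt (fun z => ∫ s in (0 : ℝ)..1, f (z, s))
      (∫ s in (0 : ℝ)..1, (fderiv ℝ f (z, s)).comp (ContinuousLinearMap.inl ℝ E ℝ)) z := by
  have hc : Continuous fun q : E × ℝ =>
      (fderiv ℝ f q).comp (ContinuousLinearMap.inl ℝ E ℝ) :=
    (hf.continuous_fderiv one_ne_zero).clm_comp continuous_const
  have hs0 : ∀ w : E, Continuous fun s : ℝ => (w, s) := fun w => by fun_prop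
  obtain ⟨C, hC⟩ := ((isCompact_closedBall z 1).prod (isCompact_Icc (a := (0 : ℝ)) (b := 1)))
    |>.exists_bound_of_continuousOn hc.continuousOn
  have hcs : ∀ w : E, Continuous fun s : ℝ => f (w, s) := fun w =>
    hf.continuous.comp (hs0 w)
  refine (intervalIntegral.hasFDerivAt_integral_of_dominated_of_fderiv_le (𝕜 := ℝ)
    (F := fun z s => f (z, s))
    (F' := fun z s => (fderiv ℝ f (z, s)).comp (ContinuousLinearMap.inl ℝ E ℝ))
    (bound := fun _ => C) (s := Metric.ball z 1)
    (Metric.ball_mem_nhds z one_pos) ?_ ?_ ?_ ?_ ?_ ?_)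
  · exact Eventually.of_forall fun w => (hcs w).aestronglyMeasurable
  · exact (hcs z).intervalIntegrable _ _
  · exact (hc.comp (by fun_prop : Continuous fun s : ℝ => (z, s))).aestronglyMeasurable
  · refine Eventually.of_forall fun s hs w hw => hC (w, s) ⟨Metric.ball_subset_closedBall hw, ?_⟩
    rw [uIoc_of_le zero_le_one] at hs
    exact ⟨hs.1.le, hs.2⟩
  · exact intervalIntegrable_const
  · refine Eventually.of_forall fun s _ w _ => ?_
    have h1 := ((hf.differentiable one_ne_zero) (w, s)).hasFDerivAt
    exact h1.comp (f := fun w : E => (w, s)) w (hasFDerivAt_prodMk_left w s)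

/-- The target space is quantified inside the induction because the derivative of the integral is an
integral of the same kind, with values in a space of linear maps. -/
theorem contDiff_nat_integral_unitInterval (n : ℕ) :
    ∀ {F : Type} [NormedAddCommGroup F] [NormedSpace ℝ F] [CompleteSpace F] {f : E × ℝ → F},
      ContDiff ℝ ∞ f → ContDiff ℝ n fun z => ∫ s in (0 : ℝ)..1, f (z, s) := by
  induction n with
  | zero =>
    intro F _ _ _ f hf
    exact contDiff_zero.2 (continuous_iff_continuousAt.2 fun z =>
      (hasFDerivAt_integral_unitInterval (hf.of_le (by simp)) z).continuousAt)
  | succ n ih =>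
    intro F _ _ _ f hf
    have h1 := hasFDerivAt_integral_unitInterval (hf.of_le (by simp))
    refine (contDiff_succ_iff_hasFDerivAt (n := n)).2 ⟨_, ?_, h1⟩
    exact ih (f := fun q => (fderiv ℝ f q).comp (ContinuousLinearMap.inl ℝ E ℝ))
      ((hf.fderiv_right (m := ∞) (by simp)).clm_comp contDiff_const)

/-- The integral over `[0, 1]` of a smooth function is a smooth function of the parameter. -/
theorem contDiff_integral_unitInterval {f : E × ℝ → F} (hf : ContDiff ℝ ∞ f) :
    ContDiff ℝ ∞ fun z => ∫ s in (0 : ℝ)..1, f (z, s) :=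
  contDiff_infty.2 fun n => contDiff_nat_integral_unitInterval n hf

/-- Taylor's formula of order zero with integral remainder along the segment `[a, a + v]`. -/
theorem eq_add_integral_segment {f : E → ℝ} (hf : ContDiff ℝ ∞ f) (a v : E) :
    f (a + v) = f a + ∫ s in (0 : ℝ)..1, fderiv ℝ f (a + s • v) v := by
  have h1 : ∀ s : ℝ, HasDerivAt (fun s : ℝ => f (a + s • v)) (fderiv ℝ f (a + s • v) v) s := by
    intro s
    have h2 : HasDerivAt (fun s : ℝ => a + s • v) v s := by
      simpa using ((hasDerivAt_id s).smul_const v).const_add a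
    exact ((hf.differentiable (by simp)) _).hasFDerivAt.comp_hasDerivAt s h2
  have hc : Continuous fun s : ℝ => fderiv ℝ f (a + s • v) v :=
    ((hf.continuous_fderiv (by simp)).comp (by fun_prop : Continuous fun s : ℝ => a + s • v)).clm_apply
      continuous_const
  rw [intervalIntegral.integral_eq_sub_of_hasDerivAt (fun s _ => h1 s) (hc.intervalIntegrable _ _)]
  simp

/-- The mean value of `G` along the segment from the origin. -/
noncomputable def radialMean (G : E → ℝ) (z : E) : ℝ := ∫ s in (0 : ℝ)..1, G (s • z)

theorem contDiff_radialMean {G : E → ℝ} (hG : ContDiff ℝ ∞ G) : ContDiff ℝ ∞ (radialMean G) :=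
  contDiff_integral_unitInterval (f := fun q : E × ℝ => G (q.2 • q.1))
    (hG.comp (contDiff_snd.smul contDiff_fst))

/-- The mean inverts E + 1: after differentiating under the integral, the left side integrates the
s-derivative of s G(sz) over [0, 1]. -/
theorem fderiv_radialMean_apply_self {G : E → ℝ} (hG : ContDiff ℝ ∞ G) (z : E) :
    fderiv ℝ (radialMean G) z z + radialMean G z = G z := by
  have hd : ∀ w, HasFDerivAt G (fderiv ℝ G w) w := fun w =>
    ((hG.differentiable (by simp)) w).hasFDerivAt
  have hf : ContDiff ℝ ∞ fun q : E × ℝ => G (q.2 • q.1) :=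
    hG.comp (contDiff_snd.smul contDiff_fst)
  have h1 := hasFDerivAt_integral_unitInterval (hf.of_le (by simp)) z
  have h2 : ∀ s : ℝ, (fderiv ℝ (fun q : E × ℝ => G (q.2 • q.1)) (z, s)).comp
      (ContinuousLinearMap.inl ℝ E ℝ) z = s * fderiv ℝ G (s • z) z := by
    intro s
    have h3 : HasFDerivAt (fun w : E => G (s • w)) ((fderiv ℝ G (s • z)).comp
        (s • ContinuousLinearMap.id ℝ E)) z :=
      (hd (s • z)).comp z ((hasFDerivAt_id z).const_smul s)
    have h4 : HasFDerivAt (fun w : E => G (s • w))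
        ((fderiv ℝ (fun q : E × ℝ => G (q.2 • q.1)) (z, s)).comp
          (ContinuousLinearMap.inl ℝ E ℝ)) z :=
      HasFDerivAt.comp (f := fun w : E => (w, s)) z ((hf.differentiable (by simp)) (z, s)).hasFDerivAt
        (hasFDerivAt_prodMk_left z s)
    rw [h4.unique h3]
    simp
  have hc1 : Continuous fun s : ℝ => fderiv ℝ G (s • z) z :=
    ((hG.continuous_fderiv (by simp)).comp (by fun_prop : Continuous fun s : ℝ => s • z)).clm_apply
      continuous_const
  have hc2 : Continuous fun s : ℝ => G (s • z) := hG.continuous.comp (by fun_prop)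
  have hc3 : Continuous fun s : ℝ => (fderiv ℝ (fun q : E × ℝ => G (q.2 • q.1)) (z, s)).comp
      (ContinuousLinearMap.inl ℝ E ℝ) :=
    ((hf.continuous_fderiv (by simp)).comp
      (by fun_prop : Continuous fun s : ℝ => (z, s))).clm_comp continuous_const
  have h5 : fderiv ℝ (radialMean G) z z = ∫ s in (0 : ℝ)..1, s * fderiv ℝ G (s • z) z := by
    have h6 : fderiv ℝ (radialMean G) z = _ := h1.fderiv
    rw [h6, ContinuousLinearMap.intervalIntegral_apply (hc3.intervalIntegrable _ _)]
    exact intervalIntegral.integral_congr fun s _ => h2 s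
  have hc4 : Continuous fun s : ℝ => s * fderiv ℝ G (s • z) z := continuous_id.mul hc1
  rw [h5, radialMean, ← intervalIntegral.integral_add
    (hc4.intervalIntegrable _ _) (hc2.intervalIntegrable _ _)]
  rw [intervalIntegral.integral_eq_sub_of_hasDerivAt (f := fun s : ℝ => s * G (s • z))
    (f' := fun s : ℝ => s * fderiv ℝ G (s • z) z + G (s • z)) (fun s _ => ?_)
    ((hc4.add hc2).intervalIntegrable _ _)]
  · simp
  · have h7 : HasDerivAt (fun s : ℝ => s • z) z s := by
      simpa using (hasDerivAt_id s).smul_const z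
    have h8 := (hasDerivAt_id s).mul ((hd (s • z)).comp_hasDerivAt s h7)
    refine h8.congr_deriv ?_
    simp
    ring

/-- A smooth function that vanishes on the kernel of a nonzero linear form is divisible by it. -/
theorem exists_contDiff_eq_mul_of_vanish {f : E → ℝ} (hf : ContDiff ℝ ∞ f) {L : E →L[ℝ] ℝ}
    (hL : L ≠ 0) (h0 : ∀ z, L z = 0 → f z = 0) :
    ∃ g : E → ℝ, ContDiff ℝ ∞ g ∧ ∀ z, f z = L z * g z := by
  obtain ⟨e₀, he₀⟩ : ∃ e, L e ≠ 0 := by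
    by_contra! h
    exact hL (ContinuousLinearMap.ext h)
  set e := (L e₀)⁻¹ • e₀ with he
  have he1 : L e = 1 := by simp [he, he₀]
  -- The segment runs from the projection of z to the kernel of L along e, where f vanishes, to z
  -- itself.
  refine ⟨fun z => ∫ s in (0 : ℝ)..1, fderiv ℝ f ((z - L z • e) + s • (L z • e)) e, ?_, ?_⟩
  · refine contDiff_integral_unitInterval
      (f := fun q : E × ℝ => fderiv ℝ f ((q.1 - L q.1 • e) + q.2 • (L q.1 • e)) e) ?_
    have h1 : ContDiff ℝ ∞ fun q : E × ℝ => (q.1 - L q.1 • e) + q.2 • (L q.1 • e) := by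
      fun_prop
    exact ((hf.fderiv_right (m := ∞) (by simp)).comp h1).clm_apply contDiff_const
  · intro z
    have h1 := eq_add_integral_segment hf (z - L z • e) (L z • e)
    rw [sub_add_cancel, h0 (z - L z • e) (by simp [he1]), zero_add] at h1
    rw [h1, ← intervalIntegral.integral_const_mul]
    exact intervalIntegral.integral_congr fun s _ => by simp

/-- A smooth cutoff function equal to one near `a` and supported in a given neighbourhood. -/
theorem exists_contDiff_cutoff {O : Set E} (hO : IsOpen O) {a : E} (ha : a ∈ O) :
    ∃ b : E → ℝ, ContDiff ℝ ∞ b ∧ tsupport b ⊆ O ∧ ∀ᶠ z in 𝓝 a, b z = 1 := by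
  obtain ⟨r, hr, hrO⟩ := Metric.nhds_basis_closedBall.mem_iff.1 (hO.mem_nhds ha)
  let b : ContDiffBump a := ⟨r / 2, r, by positivity, by linarith⟩
  exact ⟨b, b.contDiff, b.tsupport_eq ▸ hrO, b.eventuallyEq_one⟩

theorem contDiff_mul_of_tsupport_subset {O : Set E} (hO : IsOpen O) {b f : E → ℝ}
    (hb : ContDiff ℝ ∞ b) (hbO : tsupport b ⊆ O) (hf : ContDiffOn ℝ ∞ f O) :
    ContDiff ℝ ∞ fun z => b z * f z := by
  refine contDiff_iff_contDiffAt.2 fun z => ?_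
  by_cases hz : z ∈ O
  · exact hb.contDiffAt.mul (hf.contDiffAt (hO.mem_nhds hz))
  · have h1 : (fun z => b z * f z) =ᶠ[𝓝 z] fun _ => 0 := by
      filter_upwards [(isClosed_tsupport b).isOpen_compl.mem_nhds fun h => hz (hbO h)] with w hw
      rw [image_eq_zero_of_notMem_tsupport hw, zero_mul]
    exact contDiffAt_const.congr_of_eventuallyEq h1

/-- A smooth function on an open set agrees near each point with a globally smooth function. -/
theorem exists_contDiff_eventuallyEq {O : Set E} (hO : IsOpen O) {a : E} (ha : a ∈ O) {f : E → ℝ}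
    (hf : ContDiffOn ℝ ∞ f O) : ∃ g : E → ℝ, ContDiff ℝ ∞ g ∧ g =ᶠ[𝓝 a] f := by
  obtain ⟨b, hb, hbO, hb1⟩ := exists_contDiff_cutoff hO ha
  refine ⟨_, contDiff_mul_of_tsupport_subset hO hb hbO hf, ?_⟩
  filter_upwards [hb1] with z hz
  rw [hz, one_mul]

/-- Inverse function theorem for smooth maps whose derivative is invertible on an open set. -/
theorem exists_openPartialHomeomorph_of_contDiffOn {f : E → F} {O : Set E} (hO : IsOpen O)
    (hf : ContDiffOn ℝ ∞ f O) {a : E} (ha : a ∈ O)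
    (hinv : ∀ z ∈ O, ∃ f' : E ≃L[ℝ] F, HasFDerivAt f (f' : E →L[ℝ] F) z) :
    ∃ e : OpenPartialHomeomorph E F, a ∈ e.source ∧ e.source ⊆ O ∧ (∀ z, e z = f z) ∧
      ContDiffOn ℝ ∞ e.symm e.target := by
  have hfa : ∀ z ∈ O, ContDiffAt ℝ ∞ f z := fun z hz => hf.contDiffAt (hO.mem_nhds hz)
  obtain ⟨f', hf'⟩ := hinv a ha
  have : CompleteSpace E := FiniteDimensional.complete ℝ E
  -- Restricting to O keeps the derivative invertible at every source point, so the inverse is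
  -- smooth on the whole target and not only near the image of a.
  let e := ((hfa a ha).toOpenPartialHomeomorph f hf' (by simp)).restrOpen O hO
  have hsub : e.source ⊆ O := fun z hz => by
    simp only [e, OpenPartialHomeomorph.restrOpen_source] at hz
    exact hz.2
  refine ⟨e, ?_, hsub, fun z => rfl, ?_⟩
  · simp only [e, OpenPartialHomeomorph.restrOpen_source]
    exact ⟨(hfa a ha).mem_toOpenPartialHomeomorph_source hf' (by simp), ha⟩
  · intro w hw
    have hz := hsub (e.map_target hw)
    obtain ⟨g', hg'⟩ := hinv _ hz
    exact (e.contDiffAt_symm hw hg' (hfa _ hz)).contDiffWithinAt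

end Analysis

/-! ### Homogeneous polynomials and the radial equation (E - m) A = F - h -/

namespace StarLog

open Set Filter Topology

/-- Homogeneous polynomial functions of degree `m` on the plane. -/
def IsHomogeneousPoly : ℕ → (Plane → ℝ) → Prop
  | 0, h => ∃ c, ∀ z, h z = c
  | m + 1, h => ∃ h₁ h₂, IsHomogeneousPoly m h₁ ∧ IsHomogeneousPoly m h₂ ∧
      ∀ z, h z = z 0 * h₁ z + z 1 * h₂ z

theorem contDiff_coord (i : Fin 2) : ContDiff ℝ ∞ fun z : Plane => z i :=
  (EuclideanSpace.proj (𝕜 := ℝ) i : Plane →L[ℝ] ℝ).contDiff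

theorem hasFDerivAt_coord (i : Fin 2) (z : Plane) :
    HasFDerivAt (fun z : Plane => z i) (EuclideanSpace.proj (𝕜 := ℝ) i : Plane →L[ℝ] ℝ) z :=
  (EuclideanSpace.proj (𝕜 := ℝ) i : Plane →L[ℝ] ℝ).hasFDerivAt

namespace IsHomogeneousPoly

theorem contDiff {m : ℕ} : ∀ {h : Plane → ℝ}, IsHomogeneousPoly m h → ContDiff ℝ ∞ h := by
  induction m with
  | zero =>
    rintro h ⟨c, hc⟩
    rw [funext hc]
    exact contDiff_const
  | succ m ih =>
    rintro h ⟨h₁, h₂, H₁, H₂, hh⟩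
    rw [funext hh]
    exact ((contDiff_coord 0).mul (ih H₁)).add ((contDiff_coord 1).mul (ih H₂))

theorem map_smul {m : ℕ} (r : ℝ) (z : Plane) :
    ∀ {h : Plane → ℝ}, IsHomogeneousPoly m h → h (r • z) = r ^ m * h z := by
  induction m with
  | zero =>
    rintro h ⟨c, hc⟩
    simp [hc]
  | succ m ih =>
    rintro h ⟨h₁, h₂, H₁, H₂, hh⟩
    simp only [hh, ih H₁, ih H₂, PiLp.smul_apply, smul_eq_mul]
    ring

theorem add {m : ℕ} : ∀ {h g : Plane → ℝ}, IsHomogeneousPoly m h → IsHomogeneousPoly m g →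
    IsHomogeneousPoly m fun z => h z + g z := by
  induction m with
  | zero =>
    rintro h g ⟨c, hc⟩ ⟨d, hd⟩
    exact ⟨c + d, fun z => by simp only [hc, hd]⟩
  | succ m ih =>
    rintro h g ⟨h₁, h₂, H₁, H₂, hh⟩ ⟨g₁, g₂, G₁, G₂, hg⟩
    exact ⟨_, _, ih H₁ G₁, ih H₂ G₂, fun z => by simp only [hh, hg]; ring⟩

theorem const_mul {m : ℕ} (r : ℝ) : ∀ {h : Plane → ℝ}, IsHomogeneousPoly m h →
    IsHomogeneousPoly m fun z => r * h z := by
  induction m with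
  | zero =>
    rintro h ⟨c, hc⟩
    exact ⟨r * c, fun z => by simp only [hc]⟩
  | succ m ih =>
    rintro h ⟨h₁, h₂, H₁, H₂, hh⟩
    exact ⟨_, _, ih H₁, ih H₂, fun z => by simp only [hh]; ring⟩

/-- Euler's identity. -/
theorem fderiv_apply_self {m : ℕ} (z : Plane) :
    ∀ {h : Plane → ℝ}, IsHomogeneousPoly m h → fderiv ℝ h z z = m * h z := by
  intro h H
  have h1 : HasDerivAt (fun r : ℝ => r • z) z 1 := by
    simpa using (hasDerivAt_id (1 : ℝ)).smul_const z
  have h2 : HasFDerivAt h (fderiv ℝ h z) ((1 : ℝ) • z) := by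
    rw [one_smul]
    exact ((H.contDiff.differentiable (by simp)) z).hasFDerivAt
  have h3 := h2.comp_hasDerivAt (1 : ℝ) h1
  have h4 : HasDerivAt (fun r : ℝ => h (r • z)) (m * h z) 1 := by
    simp only [fun r : ℝ => H.map_smul r z]
    simpa using (hasDerivAt_pow m (1 : ℝ)).mul_const (h z)
  exact h3.unique h4

end IsHomogeneousPoly

theorem eq_coord_smul_add (z : Plane) :
    z = z 0 • EuclideanSpace.single 0 (1 : ℝ) + z 1 • EuclideanSpace.single 1 (1 : ℝ) := by
  ext i
  fin_cases i <;> simp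

/-- Hadamard's lemma at the origin of the plane. -/
theorem exists_hadamard {F : Plane → ℝ} (hF : ContDiff ℝ ∞ F) :
    ∃ G₀ G₁ : Plane → ℝ, ContDiff ℝ ∞ G₀ ∧ ContDiff ℝ ∞ G₁ ∧
      ∀ z, F z = F 0 + (z 0 * G₀ z + z 1 * G₁ z) := by
  have hd : ∀ i : Fin 2, ContDiff ℝ ∞ fun z => fderiv ℝ F z (EuclideanSpace.single i (1 : ℝ)) :=
    fun i => (hF.fderiv_right (m := ∞) (by simp)).clm_apply contDiff_const
  refine ⟨_, _, contDiff_radialMean (hd 0), contDiff_radialMean (hd 1), fun z => ?_⟩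
  have h1 := eq_add_integral_segment hF 0 z
  simp only [zero_add] at h1
  have hc : ∀ i : Fin 2, Continuous fun s : ℝ =>
      z i * fderiv ℝ F (s • z) (EuclideanSpace.single i (1 : ℝ)) := fun i =>
    continuous_const.mul ((hd i).continuous.comp (by fun_prop : Continuous fun s : ℝ => s • z))
  rw [h1, radialMean, radialMean, ← intervalIntegral.integral_const_mul,
    ← intervalIntegral.integral_const_mul, ← intervalIntegral.integral_add
      ((hc 0).intervalIntegrable _ _) ((hc 1).intervalIntegrable _ _)]
  congr 1
  refine intervalIntegral.integral_congr fun s _ => ?_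
  conv_lhs => rw [eq_coord_smul_add z]
  simp only [map_add, _root_.map_smul, smul_eq_mul]
  rw [← eq_coord_smul_add z]

/-- Since E xᵢ = xᵢ, multiplication by a coordinate turns E into E + 1; this drives the induction on
the degree in the radial equation. -/
theorem fderiv_combination_apply_self {A₀ A₁ : Plane → ℝ} (h₀ : ContDiff ℝ ∞ A₀)
    (h₁ : ContDiff ℝ ∞ A₁) (c : ℝ) (z : Plane) :
    fderiv ℝ (fun z : Plane => c + (z 0 * A₀ z + z 1 * A₁ z)) z z =
      z 0 * (fderiv ℝ A₀ z z + A₀ z) + z 1 * (fderiv ℝ A₁ z z + A₁ z) := by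
  have hA₀ := ((h₀.differentiable (by simp)) z).hasFDerivAt
  have hA₁ := ((h₁.differentiable (by simp)) z).hasFDerivAt
  have h : HasFDerivAt (fun z : Plane => c + (z 0 * A₀ z + z 1 * A₁ z)) _ z :=
    (((hasFDerivAt_coord 0 z).mul hA₀).add ((hasFDerivAt_coord 1 z).mul hA₁)).const_add c
  rw [h.fderiv]
  simp
  ring

/-- The radial equation `(E - m) A = F` for the Euler field `E` is solvable in smooth functions
up to a homogeneous polynomial of degree `m`. -/
theorem exists_radial_primitive (m : ℕ) : ∀ {F : Plane → ℝ}, ContDiff ℝ ∞ F →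
    ∃ A h : Plane → ℝ, ContDiff ℝ ∞ A ∧ IsHomogeneousPoly m h ∧
      ∀ z, fderiv ℝ A z z - m * A z = F z - h z := by
  induction m with
  | zero =>
    intro F hF
    obtain ⟨G₀, G₁, hG₀, hG₁, hG⟩ := exists_hadamard hF
    -- Functions in the image of E vanish at 0, so F(0) is left over as the homogeneous part of
    -- degree 0; the rest of F is handled by inverting E + 1 on the Hadamard factors.
    refine ⟨fun z => 0 + (z 0 * radialMean G₀ z + z 1 * radialMean G₁ z), fun _ => F 0, ?_,
      ⟨F 0, fun _ => rfl⟩, fun z => ?_⟩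
    · exact contDiff_const.add (((contDiff_coord 0).mul (contDiff_radialMean hG₀)).add
        ((contDiff_coord 1).mul (contDiff_radialMean hG₁)))
    · rw [fderiv_combination_apply_self (contDiff_radialMean hG₀) (contDiff_radialMean hG₁),
        fderiv_radialMean_apply_self hG₀, fderiv_radialMean_apply_self hG₁, hG z]
      simp
  | succ m ih =>
    intro F hF
    obtain ⟨G₀, G₁, hG₀, hG₁, hG⟩ := exists_hadamard hF
    obtain ⟨A₀, h₀, hA₀, hh₀, e₀⟩ := ih hG₀
    obtain ⟨A₁, h₁, hA₁, hh₁, e₁⟩ := ih hG₁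
    -- On constants the operator E - (m + 1) is multiplication by -(m + 1), so this constant
    -- produces F(0).
    refine ⟨fun z => -F 0 / (m + 1) + (z 0 * A₀ z + z 1 * A₁ z),
      fun z => z 0 * h₀ z + z 1 * h₁ z, ?_, ⟨h₀, h₁, hh₀, hh₁, fun _ => rfl⟩, fun z => ?_⟩
    · exact contDiff_const.add (((contDiff_coord 0).mul hA₀).add ((contDiff_coord 1).mul hA₁))
    · rw [fderiv_combination_apply_self hA₀ hA₁, hG z]
      have hm : (m : ℝ) + 1 ≠ 0 := by positivity
      push_cast
      field_simp
      linear_combination z 0 * e₀ z + z 1 * e₁ z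

end StarLog

/-! ### The radial change of coordinates -/

namespace StarLog

open Set Filter Topology

/-- The function whose level sets in `r` give the radial change of coordinates `z ↦ r z`. -/
noncomputable def radialPotential (m : ℕ) (A h : Plane → ℝ) (q : Plane × ℝ) : ℝ :=
  A (q.2 • q.1) * (q.2 ^ m)⁻¹ + h q.1 * Real.log q.2

theorem hasDerivAt_pow_inv (m : ℕ) {r : ℝ → ℝ} {r' t : ℝ} (hr : HasDerivAt r r' t)
    (h0 : r t ≠ 0) : HasDerivAt (fun t => (r t ^ m)⁻¹) (-(m * r' / r t ^ (m + 1))) t := by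
  have h1 : HasDerivAt (fun t => (r t ^ m)⁻¹) _ t := (hr.pow m).inv (pow_ne_zero m h0)
  refine h1.congr_deriv ?_
  cases m with
  | zero => simp
  | succ m =>
    simp only [Nat.add_sub_cancel, Pi.pow_apply]
    field_simp
    ring

/-- Stated along an arbitrary curve, so that it gives both the r-derivative at the origin and the
derivative along the rays t ↦ (tz, ρ(tz)). Negative r is allowed: `Real.log` is log |r|, whose
derivative is still 1/r. -/
theorem hasDerivAt_radialPotential (m : ℕ) {A h : Plane → ℝ} (hA : ContDiff ℝ ∞ A)
    (hh : ContDiff ℝ ∞ h) {z : ℝ → Plane} {r : ℝ → ℝ} {z' : Plane} {r' t : ℝ}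
    (hz : HasDerivAt z z' t) (hr : HasDerivAt r r' t) (h0 : r t ≠ 0) :
    HasDerivAt (fun t => radialPotential m A h (z t, r t))
      (fderiv ℝ A (r t • z t) (r t • z' + r' • z t) * (r t ^ m)⁻¹
        + A (r t • z t) * -(m * r' / r t ^ (m + 1))
        + (fderiv ℝ h (z t) z' * Real.log (r t) + h (z t) * (r' / r t))) t := by
  have h1 : HasDerivAt (fun t => A (r t • z t)) (fderiv ℝ A (r t • z t) (r t • z' + r' • z t)) t :=
    ((hA.differentiable (by simp)) (r t • z t)).hasFDerivAt.comp_hasDerivAt t (hr.smul hz)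
  have h2 : HasDerivAt (fun t => h (z t)) (fderiv ℝ h (z t) z') t :=
    ((hh.differentiable (by simp)) (z t)).hasFDerivAt.comp_hasDerivAt t hz
  exact (h1.mul (hasDerivAt_pow_inv m hr h0)).add (h2.mul (hr.log h0))

theorem contDiffOn_radialPotential (m : ℕ) {A h : Plane → ℝ} (hA : ContDiff ℝ ∞ A)
    (hh : ContDiff ℝ ∞ h) : ContDiffOn ℝ ∞ (radialPotential m A h) {q | q.2 ≠ 0} := by
  intro q hq
  refine ContDiffAt.contDiffWithinAt (ContDiffAt.add (ContDiffAt.mul ?_ ?_) (ContDiffAt.mul ?_ ?_))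
  · exact (hA.comp (contDiff_snd.smul contDiff_fst)).contDiffAt
  · exact (contDiff_snd.pow m).contDiffAt.inv (pow_ne_zero m hq)
  · exact (hh.comp contDiff_fst).contDiffAt
  · exact contDiff_snd.contDiffAt.log hq

/-- Implicit function theorem for a scalar equation `Φ (z, r) = Φ (z₀, r₀)`, smooth version. -/
theorem exists_contDiffOn_implicit {E : Type} [NormedAddCommGroup E] [NormedSpace ℝ E]
    [FiniteDimensional ℝ E] {Φ : E × ℝ → ℝ} {W : Set (E × ℝ)} (hW : IsOpen W)
    (hΦ : ContDiffOn ℝ ∞ Φ W) {z₀ : E} {r₀ : ℝ} (h₀ : (z₀, r₀) ∈ W)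
    (hd : fderiv ℝ Φ (z₀, r₀) (0, 1) ≠ 0) :
    ∃ (ρ : E → ℝ) (O : Set E), IsOpen O ∧ z₀ ∈ O ∧ ContDiffOn ℝ ∞ ρ O ∧ ρ z₀ = r₀ ∧
      ∀ z ∈ O, (z, ρ z) ∈ W ∧ Φ (z, ρ z) = Φ (z₀, r₀) := by
  have hc : ContinuousOn (fun q => fderiv ℝ Φ q (0, 1)) W :=
    (hΦ.continuousOn_fderiv_of_isOpen hW (by simp)).clm_apply continuousOn_const
  -- On this open set (z, r) ↦ (z, Φ(z, r)) has invertible derivative; its inverse over the slice Φ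
  -- = Φ(z₀, r₀) is the implicit function.
  set W' := W ∩ (fun q => fderiv ℝ Φ q (0, 1)) ⁻¹' {0}ᶜ
  have hW' : IsOpen W' := hc.isOpen_inter_preimage hW isOpen_compl_singleton
  have hΘ : ContDiffOn ℝ ∞ (fun q : E × ℝ => (q.1, Φ q)) W' :=
    contDiff_fst.contDiffOn.prodMk (hΦ.mono inter_subset_left)
  obtain ⟨e, he0, heW, hee, hes⟩ := exists_openPartialHomeomorph_of_contDiffOn hW' hΘ
    (a := (z₀, r₀)) ⟨h₀, hd⟩ (by
      intro q hq
      have h1 : HasFDerivAt Φ (fderiv ℝ Φ q) q :=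
        ((hΦ.contDiffAt (hW.mem_nhds hq.1)).differentiableAt (by simp)).hasFDerivAt
      have h2 := hasFDerivAt_fst.prodMk h1
      let T : E × ℝ →L[ℝ] E × ℝ := (ContinuousLinearMap.fst ℝ E ℝ).prod (fderiv ℝ Φ q)
      have hT : Function.Injective (T : E × ℝ →ₗ[ℝ] E × ℝ) := by
        rw [injective_iff_map_eq_zero]
        rintro ⟨v, s⟩ hv
        have hv1 : v = 0 := congrArg Prod.fst hv
        have hv2 : fderiv ℝ Φ q (v, s) = 0 := congrArg Prod.snd hv
        subst hv1
        have h3 : ((0 : E), s) = s • ((0 : E), (1 : ℝ)) := by simp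
        rw [h3, map_smul, smul_eq_mul] at hv2
        have hs : s = 0 := (mul_eq_zero.1 hv2).resolve_right hq.2
        simp [hs]
      refine ⟨(LinearEquiv.ofInjectiveEndo _ hT).toContinuousLinearEquiv, ?_⟩
      refine h2.congr_fderiv ?_
      ext v <;> rfl)
  have hmem : ∀ z, (z, Φ (z₀, r₀)) ∈ e.target →
      e.symm (z, Φ (z₀, r₀)) = (z, (e.symm (z, Φ (z₀, r₀))).2) ∧
      e.symm (z, Φ (z₀, r₀)) ∈ W ∧ Φ (e.symm (z, Φ (z₀, r₀))) = Φ (z₀, r₀) := by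
    intro z hz
    have h1 := e.right_inv hz
    rw [hee] at h1
    have h2 := congrArg Prod.fst h1
    have h3 := congrArg Prod.snd h1
    exact ⟨Prod.ext h2 rfl, (heW (e.map_target hz)).1, h3⟩
  have he0' : e (z₀, r₀) = (z₀, Φ (z₀, r₀)) := hee _
  have hcont : Continuous fun z : E => (z, Φ (z₀, r₀)) := by fun_prop
  refine ⟨fun z => (e.symm (z, Φ (z₀, r₀))).2, {z | (z, Φ (z₀, r₀)) ∈ e.target},
    e.open_target.preimage hcont, ?_, ?_, ?_, ?_⟩
  · rw [mem_ofPred_eq, ← he0']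
    exact e.map_source he0
  · exact contDiff_snd.comp_contDiffOn (hes.comp
      (contDiff_id.prodMk contDiff_const).contDiffOn fun z hz => hz)
  · simp only
    rw [← he0', e.left_inv he0]
  · intro z hz
    obtain ⟨h1, h2, h3⟩ := hmem z hz
    exact ⟨h1 ▸ h2, by rw [← h1]; exact h3⟩

/-- A smooth radial rescaling `z ↦ ρ z` that reduces `F` to a constant plus a homogeneous
polynomial of degree `m`, up to a power of `ρ`. -/
theorem exists_radial_scaling {F : Plane → ℝ} (hF : ContDiff ℝ ∞ F) (hF0 : F 0 ≠ 0) (m : ℕ)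
    {r₀ : ℝ} (hr₀ : r₀ ≠ 0) :
    ∃ (h ρ : Plane → ℝ) (c : ℝ) (O : Set Plane), IsHomogeneousPoly m h ∧ IsOpen O ∧ 0 ∈ O ∧
      ContDiffOn ℝ ∞ ρ O ∧ ρ 0 = r₀ ∧ (m = 0 → c = 0) ∧ (m ≠ 0 → c = F 0 / r₀ ^ m) ∧
      ∀ z ∈ O, ρ z ≠ 0 ∧
        (ρ z + fderiv ℝ ρ z z) * F (ρ z • z) = (c + h z) * ρ z ^ (m + 1) := by
  obtain ⟨A, h, hA, hh, hAh⟩ := exists_radial_primitive m hF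
  have hW : IsOpen {q : Plane × ℝ | q.2 ≠ 0} := isOpen_ne_fun continuous_snd continuous_const
  have hA0 : -(m * A 0) = F 0 - h 0 := by simpa using hAh 0
  -- Either m = 0 or h(0) = 0; this identity covers both cases at once.
  have hh0 : h 0 = r₀ ^ m * h 0 := by simpa using hh.map_smul r₀ 0
  have hΦ := contDiffOn_radialPotential m hA hh.contDiff
  -- The r-derivative at the origin is F(0) / r₀^(m+1).
  have hd : fderiv ℝ (radialPotential m A h) (0, r₀) (0, 1) ≠ 0 := by
    have h1 := hasDerivAt_radialPotential m hA hh.contDiff (hasDerivAt_const r₀ (0 : Plane))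
      (hasDerivAt_id r₀) hr₀
    have h2 : HasFDerivAt (radialPotential m A h) (fderiv ℝ (radialPotential m A h) (0, r₀))
        (0, r₀) :=
      ((hΦ.contDiffAt (hW.mem_nhds hr₀)).differentiableAt (by simp)).hasFDerivAt
    have h3 : HasDerivAt (fun r : ℝ => radialPotential m A h (0, r)) _ r₀ :=
      h2.comp_hasDerivAt r₀ ((hasDerivAt_const r₀ (0 : Plane)).prodMk (hasDerivAt_id r₀))
    rw [h3.unique h1]
    have h4 : A 0 * -((m : ℝ) / r₀ ^ (m + 1)) + h 0 * (1 / r₀) = F 0 / r₀ ^ (m + 1) := by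
      field_simp
      rw [pow_succ]
      linear_combination r₀ * hA0 - r₀ * hh0
    simpa [hF0, hr₀] using h4.trans_ne (div_ne_zero hF0 (pow_ne_zero _ hr₀))
  obtain ⟨ρ, O, hO, h0O, hρ, hρ0, hρΦ⟩ := exists_contDiffOn_implicit hW hΦ hr₀ hd
  refine ⟨h, ρ, -(m * radialPotential m A h (0, r₀)), O, hh, hO, h0O, hρ, hρ0, ?_, ?_, ?_⟩
  · rintro rfl
    simp
  · intro hm
    have hh00 : h 0 = 0 := by
      have := hh.map_smul 0 0
      simpa [hm] using this
    simp only [radialPotential, smul_zero, hh00]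
    rw [hh00, sub_zero] at hA0
    rw [← hA0]
    ring
  · intro z hz
    have hρz : ρ z ≠ 0 := (hρΦ z hz).1
    refine ⟨hρz, ?_⟩
    have hz1 : HasDerivAt (fun t : ℝ => t • z) z 1 := by
      simpa using (hasDerivAt_id (1 : ℝ)).smul_const z
    have hρ1 : HasFDerivAt ρ (fderiv ℝ ρ z) ((1 : ℝ) • z) := by
      rw [one_smul]
      exact ((hρ.contDiffAt (hO.mem_nhds hz)).differentiableAt (by simp)).hasFDerivAt
    have hr1 : HasDerivAt (fun t : ℝ => ρ (t • z)) (fderiv ℝ ρ z z) 1 :=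
      hρ1.comp_hasDerivAt (1 : ℝ) hz1
    have h1 := hasDerivAt_radialPotential m hA hh.contDiff hz1 hr1 (by simpa using hρz)
    -- The potential is constant along the ray, so its radial derivative vanishes; with the radial
    -- equation at ρ(z) z and Euler's identity for h, this is the required identity.
    have h2 : (fun t : ℝ => radialPotential m A h (t • z, ρ (t • z))) =ᶠ[𝓝 1]
        fun _ => radialPotential m A h (0, r₀) := by
      have h3 : ∀ᶠ t : ℝ in 𝓝 1, t • z ∈ O := by
        refine hz1.continuousAt.eventually_mem (hO.mem_nhds ?_)
        simpa using hz
      filter_upwards [h3] with t ht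
      exact (hρΦ _ ht).2
    have h4 := h1.unique ((hasDerivAt_const (1 : ℝ) _).congr_of_eventuallyEq h2)
    simp only [one_smul] at h4
    have h5 := hAh (ρ z • z)
    have h6 : fderiv ℝ A (ρ z • z) (ρ z • z + fderiv ℝ ρ z z • z) * ρ z
        = (ρ z + fderiv ℝ ρ z z) * fderiv ℝ A (ρ z • z) (ρ z • z) := by
      simp only [map_add, map_smul, smul_eq_mul]
      ring
    rw [hh.fderiv_apply_self z] at h4
    rw [hh.map_smul] at h5
    rw [← (hρΦ z hz).2]
    simp only [radialPotential]
    generalize fderiv ℝ A (ρ z • z) (ρ z • z + fderiv ℝ ρ z z • z) = X at *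
    generalize fderiv ℝ A (ρ z • z) (ρ z • z) = Y at *
    generalize fderiv ℝ ρ z z = D at *
    generalize A (ρ z • z) = a at *
    generalize F (ρ z • z) = f at *
    generalize Real.log (ρ z) = l at *
    generalize h z = b at *
    generalize ρ z = r at *
    have hp : r ^ m ≠ 0 := pow_ne_zero m hρz
    rw [pow_succ] at *
    field_simp at h4 ⊢
    linear_combination h4 - h6 - (r + D) * h5

end StarLog

/-! ### Partial fractions for products of linear forms -/

namespace StarLog

/-- The sum of `f i j` over the pairs `i < j` in `s`. -/
def pairSum {n : ℕ} (s : Finset (Fin n)) (f : Fin n → Fin n → ℝ) : ℝ :=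
  ∑ i ∈ s, ∑ j ∈ s with i < j, f i j

/-- Lets an expansion over a subset of the lines be read over all lines, with zero coefficients for
the missing pairs. -/
theorem pairSum_mono {n : ℕ} {s t : Finset (Fin n)} (hst : s ⊆ t) (f g : Fin n → Fin n → ℝ)
    (hfg : ∀ i ∈ s, ∀ j ∈ s, f i j = g i j) (h0 : ∀ i j, i ∉ s ∨ j ∉ s → g i j = 0) :
    pairSum s f = pairSum t g := by
  have h1 : pairSum s f = pairSum s g :=
    Finset.sum_congr rfl fun i hi => Finset.sum_congr rfl fun j hj =>
      hfg i hi j (Finset.mem_filter.1 hj).1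
  rw [h1]
  unfold pairSum
  rw [← Finset.sum_subset hst fun i _ hi => Finset.sum_eq_zero fun j _ => h0 i j (Or.inl hi)]
  refine Finset.sum_congr rfl fun i _ =>
    Finset.sum_subset (Finset.filter_subset_filter _ hst) fun j hj hj' => h0 i j (Or.inr ?_)
  simp only [Finset.mem_filter] at hj hj'
  exact fun h => hj' ⟨h, hj.2⟩

theorem pairSum_add {n : ℕ} (s : Finset (Fin n)) (f g : Fin n → Fin n → ℝ) :
    pairSum s (fun i j => f i j + g i j) = pairSum s f + pairSum s g := by
  simp only [pairSum, Finset.sum_add_distrib]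

theorem pairSum_insert_of_lt {n : ℕ} {s : Finset (Fin n)} {a : Fin n} (ha : ∀ i ∈ s, a < i)
    (f : Fin n → Fin n → ℝ) : pairSum (insert a s) f = ∑ i ∈ s, f a i + pairSum s f := by
  have hs : a ∉ s := fun h => lt_irrefl _ (ha a h)
  unfold pairSum
  rw [Finset.sum_insert hs]
  congr 1
  · rw [Finset.filter_insert, if_neg (lt_irrefl a), Finset.filter_true_of_mem ha]
  · refine Finset.sum_congr rfl fun i hi => ?_
    rw [Finset.filter_insert, if_neg (not_lt.2 (ha i hi).le)]

/-- Partial fractions: a homogeneous polynomial of degree `m` over a product of `m + 2` pairwise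
independent linear forms is a linear combination of the inverses of products of two of them. -/
theorem exists_partialFractions {n : ℕ} (a b : Fin n → ℝ) (m : ℕ) :
    ∀ (s : Finset (Fin n)) (h : Plane → ℝ), s.card = m + 2 →
      (∀ i ∈ s, ∀ j ∈ s, i ≠ j → a i * b j - a j * b i ≠ 0) → IsHomogeneousPoly m h →
      ∃ ν : Fin n → Fin n → ℝ, ∀ z : Plane, (∀ i ∈ s, a i * z 0 + b i * z 1 ≠ 0) →
        h z / ∏ i ∈ s, (a i * z 0 + b i * z 1) =
          pairSum s fun i j => ν i j / ((a i * z 0 + b i * z 1) * (a j * z 0 + b j * z 1)) := by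
  induction m with
  | zero =>
    rintro s h hs _ ⟨c, hc⟩
    obtain ⟨i, j, hij, rfl⟩ := Finset.card_eq_two.1 hs
    wlog hlt : i < j generalizing i j
    · rw [Finset.pair_comm]
      exact this j i hij.symm (by rwa [Finset.pair_comm]) (by rwa [Finset.pair_comm])
        (lt_of_le_of_ne (not_lt.1 hlt) hij.symm)
    refine ⟨fun _ _ => c, fun z _ => ?_⟩
    rw [pairSum_insert_of_lt (by simpa using hlt), Finset.prod_pair hij, hc]
    simp [pairSum, Finset.filter_singleton]
  | succ m ih =>
    rintro s h hs hind ⟨h₁, h₂, H₁, H₂, hh⟩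
    obtain ⟨i, hi, j, hj, hij⟩ := Finset.one_lt_card.1 (by omega : 1 < s.card)
    have hΔ := hind i hi j hj hij
    set Δ := a i * b j - a j * b i with hΔdef
    have hsub : ∀ l ∈ s, ∀ g : Plane → ℝ, IsHomogeneousPoly m g → ∃ ν : Fin n → Fin n → ℝ,
        ∀ z : Plane, (∀ i ∈ s, a i * z 0 + b i * z 1 ≠ 0) →
        (a l * z 0 + b l * z 1) * g z / ∏ i ∈ s, (a i * z 0 + b i * z 1) =
          pairSum s fun i j =>
            ν i j / ((a i * z 0 + b i * z 1) * (a j * z 0 + b j * z 1)) := by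
      intro l hl g hg
      obtain ⟨ν, hν⟩ := ih (s.erase l) g (by rw [Finset.card_erase_of_mem hl]; omega)
        (fun i hi j hj => hind i (Finset.mem_of_mem_erase hi) j (Finset.mem_of_mem_erase hj)) hg
      refine ⟨fun i j => if i ∈ s.erase l ∧ j ∈ s.erase l then ν i j else 0, fun z hz => ?_⟩
      rw [← Finset.mul_prod_erase s _ hl, mul_div_mul_left _ _ (hz l hl),
        hν z fun i hi => hz i (Finset.mem_of_mem_erase hi)]
      refine pairSum_mono (Finset.erase_subset l s) _ _ (fun i hi j hj => ?_) fun i j hij => ?_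
      · beta_reduce
        rw [if_pos ⟨hi, hj⟩]
      · beta_reduce
        rw [if_neg (by tauto), zero_div]
    -- By Cramer's rule x = (b_j L_i - b_i L_j)/Δ and y = (a_i L_j - a_j L_i)/Δ. Substituting in x
    -- h₁ + y h₂ gives a multiple of L_i plus a multiple of L_j, and each cancels one factor of the
    -- denominator.
    obtain ⟨ν₁, hν₁⟩ := hsub i hi (fun z => b j / Δ * h₁ z + -a j / Δ * h₂ z)
      ((H₁.const_mul _).add (H₂.const_mul _))
    obtain ⟨ν₂, hν₂⟩ := hsub j hj (fun z => -b i / Δ * h₁ z + a i / Δ * h₂ z)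
      ((H₁.const_mul _).add (H₂.const_mul _))
    refine ⟨fun i j => ν₁ i j + ν₂ i j, fun z hz => ?_⟩
    simp only [add_div]
    rw [pairSum_add, ← hν₁ z hz, ← hν₂ z hz, ← add_div, hh]
    congr 1
    field_simp
    rw [hΔdef]
    ring

/-- Partial fractions for `x`, `y` and further linear forms, without the term `1 / (x y)`. -/
theorem exists_partialFractions_coord {n : ℕ} {α β : Fin n} {o : Finset (Fin n)} (hαβ : α < β)
    (ho : ∀ i ∈ o, β < i) (A B : Fin n → ℝ) (hAB : ∀ i ∈ o, A i ≠ 0 ∧ B i ≠ 0)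
    (hind : ∀ i ∈ o, ∀ j ∈ o, i ≠ j → A i * B j - A j * B i ≠ 0) (hne : o.Nonempty)
    {h : Plane → ℝ} (hh : IsHomogeneousPoly o.card h) :
    ∃ (lam del : Fin n → ℝ) (nu : Fin n → Fin n → ℝ), ∀ z : Plane, z 0 ≠ 0 → z 1 ≠ 0 →
      (∀ i ∈ o, A i * z 0 + B i * z 1 ≠ 0) →
      h z / (z 0 * z 1 * ∏ i ∈ o, (A i * z 0 + B i * z 1)) =
        ∑ i ∈ o, (lam i / (z 0 * (A i * z 0 + B i * z 1))
          + del i / (z 1 * (A i * z 0 + B i * z 1)))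
        + ∑ i ∈ o, ∑ j ∈ o with i < j,
          nu i j / ((A i * z 0 + B i * z 1) * (A j * z 0 + B j * z 1)) := by
  classical
  have hα : ∀ i ∈ o, i ≠ α := fun i hi => (hαβ.trans (ho i hi)).ne'
  have hβ : ∀ i ∈ o, i ≠ β := fun i hi => (ho i hi).ne'
  have hβo : β ∉ o := fun h => hβ β h rfl
  have hαo : α ∉ insert β o := by
    rw [Finset.mem_insert, not_or]
    exact ⟨hαβ.ne, fun h => hα α h rfl⟩
  let a : Fin n → ℝ := fun i => if i = α then 1 else if i = β then 0 else A i
  let b : Fin n → ℝ := fun i => if i = α then 0 else if i = β then 1 else B i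
  have haα : a α = 1 := if_pos rfl
  have hbα : b α = 0 := if_pos rfl
  have haβ : a β = 0 := by simp [a, hαβ.ne']
  have hbβ : b β = 1 := by simp [b, hαβ.ne']
  have hai : ∀ i ∈ o, a i = A i := fun i hi => by simp [a, hα i hi, hβ i hi]
  have hbi : ∀ i ∈ o, b i = B i := fun i hi => by simp [b, hα i hi, hβ i hi]
  have hcard : (insert α (insert β o)).card = o.card + 2 := by
    rw [Finset.card_insert_of_notMem hαo, Finset.card_insert_of_notMem hβo]
  obtain ⟨ν, hν⟩ := exists_partialFractions a b o.card (insert α (insert β o)) h hcard (by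
    intro i hi j hj hij
    rw [Finset.mem_insert, Finset.mem_insert] at hi hj
    rcases hi with rfl | rfl | hi <;> rcases hj with rfl | rfl | hj
    · exact absurd rfl hij
    · simp [haα, hbα, haβ, hbβ]
    · simpa [haα, hbα, hbi j hj] using (hAB j hj).2
    · simp [haα, hbα, haβ, hbβ]
    · exact absurd rfl hij
    · simpa [haβ, hbβ, hai j hj] using (hAB j hj).1
    · simpa [haα, hbα, hbi i hi] using (hAB i hi).2
    · simpa [haβ, hbβ, hai i hi] using (hAB i hi).1
    · rw [hai i hi, hai j hj, hbi i hi, hbi j hj]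
      exact hind i hi j hj hij) hh
  obtain ⟨e, he⟩ := hne
  -- The unwanted 1/(xy) is moved to the line e through 1/(xy) = B_e/(x L_e) + A_e/(y L_e), which is
  -- where a third line is needed.
  refine ⟨fun i => ν α i + if i = e then ν α β * B e else 0,
    fun i => ν β i + if i = e then ν α β * A e else 0, ν, fun z hx hy hz => ?_⟩
  have h1 := hν z (by
    intro i hi
    rw [Finset.mem_insert, Finset.mem_insert] at hi
    rcases hi with rfl | rfl | hi
    · simpa [haα, hbα] using hx
    · simpa [haβ, hbβ] using hy
    · rw [hai i hi, hbi i hi]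
      exact hz i hi)
  rw [Finset.prod_insert hαo, Finset.prod_insert hβo, pairSum_insert_of_lt (by
    intro i hi
    rcases Finset.mem_insert.1 hi with rfl | hi
    · exact hαβ
    · exact hαβ.trans (ho i hi)), pairSum_insert_of_lt ho, Finset.sum_insert hβo] at h1
  simp only [haα, hbα, haβ, hbβ, one_mul, zero_mul, add_zero, zero_add] at h1
  have hprod : ∏ i ∈ o, (a i * z 0 + b i * z 1) = ∏ i ∈ o, (A i * z 0 + B i * z 1) :=
    Finset.prod_congr rfl fun i hi => by rw [hai i hi, hbi i hi]
  have hs1 : ∑ i ∈ o, ν α i / (z 0 * (a i * z 0 + b i * z 1))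
      = ∑ i ∈ o, ν α i / (z 0 * (A i * z 0 + B i * z 1)) :=
    Finset.sum_congr rfl fun i hi => by rw [hai i hi, hbi i hi]
  have hs2 : ∑ i ∈ o, ν β i / (z 1 * (a i * z 0 + b i * z 1))
      = ∑ i ∈ o, ν β i / (z 1 * (A i * z 0 + B i * z 1)) :=
    Finset.sum_congr rfl fun i hi => by rw [hai i hi, hbi i hi]
  have hs3 : pairSum o (fun i j => ν i j / ((a i * z 0 + b i * z 1) * (a j * z 0 + b j * z 1)))
      = ∑ i ∈ o, ∑ j ∈ o with i < j,
          ν i j / ((A i * z 0 + B i * z 1) * (A j * z 0 + B j * z 1)) :=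
    Finset.sum_congr rfl fun i hi => Finset.sum_congr rfl fun j hj => by
      have hj' := (Finset.mem_filter.1 hj).1
      beta_reduce
      rw [hai i hi, hbi i hi, hai j hj', hbi j hj']
  rw [hprod, hs1, hs2, hs3, ← mul_assoc] at h1
  rw [h1]
  simp only [add_div, Finset.sum_add_distrib, ite_div, zero_div]
  rw [Finset.sum_ite_eq' o e, Finset.sum_ite_eq' o e, if_pos he, if_pos he]
  have h2 : ν α β / (z 0 * z 1) = ν α β * B e / (z 0 * (A e * z 0 + B e * z 1))
      + ν α β * A e / (z 1 * (A e * z 0 + B e * z 1)) := by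
    have hL := hz e he
    rw [div_add_div _ _ (mul_ne_zero hx hL) (mul_ne_zero hy hL),
      div_eq_div_iff (mul_ne_zero hx hy) (mul_ne_zero (mul_ne_zero hx hL) (mul_ne_zero hy hL))]
    ring
  rw [h2]
  ring

end StarLog

/-! ### Functions vanishing on lines, and vector fields read in a chart -/

namespace StarLog

open Set Filter Topology

/-- The determinant of a pair of vectors of the plane. -/
def planeDet (v w : Plane) : ℝ := v 0 * w 1 - w 0 * v 1

/-- The linear form `a x + b y` on the plane. -/
noncomputable def linForm (a b : ℝ) : Plane →L[ℝ] ℝ :=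
  a • (EuclideanSpace.proj (𝕜 := ℝ) 0 : Plane →L[ℝ] ℝ) + b • EuclideanSpace.proj (𝕜 := ℝ) 1

theorem linForm_apply (a b : ℝ) (z : Plane) : linForm a b z = a * z 0 + b * z 1 := by
  simp [linForm]

theorem coeff_ne_zero_of_linForm_ne_zero {a b : ℝ} (h : linForm a b ≠ 0) : a ≠ 0 ∨ b ≠ 0 := by
  by_contra! h0
  exact h (by simp [linForm, h0.1, h0.2])

theorem planeDet_eq_zero_of_linForm {a b : ℝ} (h : linForm a b ≠ 0) {v w : Plane}
    (hv : linForm a b v = 0) (hw : linForm a b w = 0) : planeDet v w = 0 := by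
  rw [linForm_apply] at hv hw
  unfold planeDet
  rcases coeff_ne_zero_of_linForm_ne_zero h with h | h
  · refine mul_left_cancel₀ h ?_
    linear_combination w 1 * hv - v 1 * hw
  · refine mul_left_cancel₀ h ?_
    linear_combination v 0 * hw - w 0 * hv

/-- A smooth function that vanishes on finitely many distinct lines through the origin is
divisible by the product of their equations. -/
theorem exists_contDiff_eq_prod_mul {ι : Type} [DecidableEq ι] (a b : ι → ℝ) {f : Plane → ℝ}
    (hf : ContDiff ℝ ∞ f) (s : Finset ι) (hne : ∀ i ∈ s, linForm (a i) (b i) ≠ 0)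
    (hind : ∀ i ∈ s, ∀ j ∈ s, i ≠ j → a i * b j - a j * b i ≠ 0)
    (h0 : ∀ i ∈ s, ∀ z, linForm (a i) (b i) z = 0 → f z = 0) :
    ∃ g : Plane → ℝ, ContDiff ℝ ∞ g ∧ ∀ z, f z = (∏ i ∈ s, linForm (a i) (b i) z) * g z := by
  induction s using Finset.induction_on with
  | empty => exact ⟨f, hf, by simp⟩
  | insert i s his ih =>
    obtain ⟨g, hg, hfg⟩ := ih (fun j hj => hne j (Finset.mem_insert_of_mem hj))
      (fun j hj l hl => hind j (Finset.mem_insert_of_mem hj) l (Finset.mem_insert_of_mem hl))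
      (fun j hj => h0 j (Finset.mem_insert_of_mem hj))
    have hi := Finset.mem_insert_self i s
    -- Away from the origin the new line meets none of the earlier ones, so their product can be
    -- cancelled. The origin itself follows by continuity along the direction vector of the new
    -- line.
    have h1 : ∀ z : Plane, z ≠ 0 → linForm (a i) (b i) z = 0 → g z = 0 := by
      intro z hz hiz
      have h2 := hfg z
      rw [h0 i hi z hiz, eq_comm, mul_eq_zero] at h2
      refine h2.resolve_left (Finset.prod_ne_zero_iff.2 fun j hj hjz => hz ?_)
      have h3 := hind i hi j (Finset.mem_insert_of_mem hj) (fun h => his (h ▸ hj))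
      rw [linForm_apply] at hiz hjz
      have hz0 : z 0 = 0 := mul_left_cancel₀ h3 (by linear_combination b j * hiz - b i * hjz)
      have hz1 : z 1 = 0 := mul_left_cancel₀ h3 (by linear_combination a i * hjz - a j * hiz)
      ext l
      fin_cases l
      · exact hz0
      · exact hz1
    have h2 : ∀ z : Plane, linForm (a i) (b i) z = 0 → g z = 0 := by
      intro z hz
      rcases eq_or_ne z 0 with rfl | hz0
      · let v : Plane := !₂[-b i, a i]
        have hv : v ≠ 0 := by
          intro hv
          have hv0 : v 0 = 0 := by rw [hv]; rfl
          have hv1 : v 1 = 0 := by rw [hv]; rfl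
          simp [v] at hv0 hv1
          rcases coeff_ne_zero_of_linForm_ne_zero (hne i hi) with h | h
          · exact h hv1
          · exact h hv0
        have hc : Continuous fun t : ℝ => g (t • v) := hg.continuous.comp (by fun_prop)
        have h4 : Tendsto (fun t : ℝ => g (t • v)) (𝓝[≠] 0) (𝓝 (g 0)) := by
          simpa using (hc.tendsto 0).mono_left nhdsWithin_le_nhds
        refine tendsto_nhds_unique h4 (tendsto_const_nhds.congr' ?_)
        filter_upwards [self_mem_nhdsWithin] with t ht
        refine (h1 _ (smul_ne_zero ht hv) ?_).symm
        have hv' : linForm (a i) (b i) v = 0 := by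
          simp [linForm_apply, v]
          ring
        rw [map_smul, hv', smul_zero]
      · exact h1 z hz0 hz
    obtain ⟨k, hk, hgk⟩ := exists_contDiff_eq_mul_of_vanish hg (hne i hi) h2
    refine ⟨k, hk, fun z => ?_⟩
    rw [Finset.prod_insert his, hfg, hgk]
    ring

/-- An alternating 2-form on the plane is a multiple of the determinant. -/
theorem alternating_plane_apply (η : Plane [⋀^Fin 2]→L[ℝ] ℝ) (v w : Plane) :
    η ![v, w] = η ![EuclideanSpace.single 0 1, EuclideanSpace.single 1 1] * planeDet v w := by
  let b := (EuclideanSpace.basisFun (Fin 2) ℝ).toBasis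
  have h := congrArg (fun f : Plane [⋀^Fin 2]→ₗ[ℝ] ℝ => f ![v, w])
    (η.toAlternatingMap.eq_smul_basis_det b)
  have hb : (b : Fin 2 → Plane) = ![EuclideanSpace.single 0 1, EuclideanSpace.single 1 1] := by
    funext i
    fin_cases i <;> simp [b]
  simp only [AlternatingMap.smul_apply, smul_eq_mul, hb] at h
  refine h.trans ?_
  congr 1
  simp [b, Module.Basis.det_apply, Matrix.det_fin_two, Module.Basis.toMatrix_apply, planeDet]

section Chart

variable {S : Type*} [TopologicalSpace S] [ChartedSpace Plane S] [IsManifold (𝓡 2) ∞ S]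
  {e : OpenPartialHomeomorph S Plane}

/-- The differential of a chart at `q`, as a map to the plane. -/
noncomputable def chartDeriv (e : OpenPartialHomeomorph S Plane) (q : S) :
    TangentSpace (𝓡 2) q →L[ℝ] Plane :=
  mfderiv (𝓡 2) (𝓡 2) e q

theorem mdifferentiable_of_mem_maximalAtlas
    (he : e ∈ IsManifold.maximalAtlas (𝓡 2) ∞ S) : e.MDifferentiable (𝓡 2) (𝓡 2) :=
  ⟨(contMDiffOn_of_mem_maximalAtlas he).mdifferentiableOn (by simp),
    (contMDiffOn_symm_of_mem_maximalAtlas he).mdifferentiableOn (by simp)⟩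

theorem isInvertible_chartDeriv (he : e ∈ IsManifold.maximalAtlas (𝓡 2) ∞ S) {q : S}
    (hq : q ∈ e.source) : (chartDeriv e q).IsInvertible :=
  ⟨(mdifferentiable_of_mem_maximalAtlas he).mfderiv hq, rfl⟩

/-- The vector field on the surface with coordinate expression `V`. -/
noncomputable def chartField (e : OpenPartialHomeomorph S Plane) (V : Plane → Plane) (q : S) :
    TangentSpace (𝓡 2) q :=
  (chartDeriv e q).inverse (V (e q))

theorem chartDeriv_chartField (he : e ∈ IsManifold.maximalAtlas (𝓡 2) ∞ S) {q : S}
    (hq : q ∈ e.source) (V : Plane → Plane) : chartDeriv e q (chartField e V q) = V (e q) :=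
  (isInvertible_chartDeriv he hq).self_apply_inverse _

theorem contMDiffOn_chartField (he : e ∈ IsManifold.maximalAtlas (𝓡 2) ∞ S) {V : Plane → Plane}
    (hV : ContDiff ℝ ∞ V) : ContMDiffOn (𝓡 2) (𝓡 2).tangent ∞
      (fun q => (⟨q, chartField e V q⟩ : TangentBundle (𝓡 2) S)) e.source := by
  intro q hq
  have h1 : ContMDiffAt (𝓡 2) (𝓡 2).tangent ∞
      (fun z => (⟨z, V z⟩ : TangentBundle (𝓡 2) Plane)) (e q) :=
    contMDiffAt_vectorSpace_iff_contDiffAt.2 hV.contDiffAt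
  exact (ContMDiffAt.mpullback_vectorField_preimage (n := ∞) h1
    (contMDiffAt_of_mem_maximalAtlas he hq) (isInvertible_chartDeriv he hq)
    (by simp)).contMDiffWithinAt

/-- The coordinate expression of X is its pullback by the inverse chart, for which smoothness of
vector fields is preserved. -/
theorem contDiffOn_chartDeriv (he : e ∈ IsManifold.maximalAtlas (𝓡 2) ∞ S) {U : Set S}
    (hU : IsOpen U) {X : ∀ q : S, TangentSpace (𝓡 2) q}
    (hX : ContMDiffOn (𝓡 2) (𝓡 2).tangent ∞ (fun q => (⟨q, X q⟩ : TangentBundle (𝓡 2) S)) U) :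
    ContDiffOn ℝ ∞ (fun z => chartDeriv e (e.symm z) (X (e.symm z)))
      (e.target ∩ e.symm ⁻¹' U) := by
  rintro z ⟨hz, hzU⟩
  have hm := mdifferentiable_of_mem_maximalAtlas he
  have h0 : ContMDiffAt (𝓡 2) (𝓡 2).tangent ∞
      (fun z => (⟨z, VectorField.mpullback (𝓡 2) (𝓡 2) e.symm X z⟩ : TangentBundle (𝓡 2) Plane))
        z :=
    ContMDiffAt.mpullback_vectorField_preimage (n := ∞) (hX.contMDiffAt (hU.mem_nhds hzU))
      (contMDiffAt_symm_of_mem_maximalAtlas he hz) ⟨hm.symm.mfderiv hz, rfl⟩ (by simp)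
  have h1 : ContDiffAt ℝ ∞ (VectorField.mpullback (𝓡 2) (𝓡 2) e.symm X) z :=
    contMDiffAt_vectorSpace_iff_contDiffAt.1 h0
  refine (h1.congr_of_eventuallyEq ?_).contDiffWithinAt
  filter_upwards [e.open_target.mem_nhds hz] with w hw
  have h3 : (mfderiv (𝓡 2) (𝓡 2) e.symm w).IsInvertible := ⟨hm.symm.mfderiv hw, rfl⟩
  have h4 : (mfderiv (𝓡 2) (𝓡 2) e.symm w)
      (chartDeriv e (e.symm w) (X (e.symm w))) = X (e.symm w) := by
    have h5 := hm.symm_comp_deriv (e.map_target hw)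
    have h6 := congrArg (fun L => L (X (e.symm w))) h5
    simp only [ContinuousLinearMap.comp_apply] at h6
    rw [e.right_inv hw] at h6
    exact h6
  rw [VectorField.mpullback_apply]
  refine (h3.inverse_apply_eq.2 h4.symm).symm

end Chart

end StarLog

/-! ### Tangent lines and 2-forms in a chart -/

namespace StarLog

open Set Filter Topology

section Tangent

variable {S : Type*} [TopologicalSpace S] [ChartedSpace Plane S] [IsManifold (𝓡 2) ∞ S]
  {e : OpenPartialHomeomorph S Plane}

theorem hasMFDerivAt_chart (he : e ∈ IsManifold.maximalAtlas (𝓡 2) ∞ S) {q : S}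
    (hq : q ∈ e.source) : HasMFDerivAt (𝓡 2) (𝓡 2) e q (chartDeriv e q) :=
  ((contMDiffAt_of_mem_maximalAtlas he hq).mdifferentiableAt (by simp)).hasMFDerivAt

theorem hasMFDerivAt_comp_chart (he : e ∈ IsManifold.maximalAtlas (𝓡 2) ∞ S) {q : S}
    (hq : q ∈ e.source) (L : Plane →L[ℝ] ℝ) :
    HasMFDerivAt (𝓡 2) 𝓘(ℝ, ℝ) (fun q => L (e q)) q (L.comp (chartDeriv e q)) :=
  HasMFDerivAt.comp q L.hasMFDerivAt (hasMFDerivAt_chart he hq)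

theorem mfderiv_comp_chart_apply (he : e ∈ IsManifold.maximalAtlas (𝓡 2) ∞ S) {q : S}
    (hq : q ∈ e.source) (L : Plane →L[ℝ] ℝ) (v : TangentSpace (𝓡 2) q) :
    mfderiv (𝓡 2) 𝓘(ℝ, ℝ) (fun q => L (e q)) q v = L (chartDeriv e q v) := by
  rw [(hasMFDerivAt_comp_chart he hq L).mfderiv]
  rfl

/-- A nonzero linear form in a chart is a defining function of its zero set. -/
theorem isDefiningFunctionOn_linear (he : e ∈ IsManifold.maximalAtlas (𝓡 2) ∞ S) {c : Set S}
    {L : Plane →L[ℝ] ℝ} (hL : L ≠ 0) (hc : ∀ q ∈ e.source, q ∈ c ↔ L (e q) = 0) :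
    IsDefiningFunctionOn c e.source fun q => L (e q) where
  isOpen := e.open_source
  contMDiffOn := L.contMDiff.comp_contMDiffOn (contMDiffOn_of_mem_maximalAtlas he)
  mem_iff := hc
  mfderiv_ne_zero := by
    intro q hq _ h0
    refine hL (ContinuousLinearMap.ext fun z => ?_)
    obtain ⟨v, rfl⟩ := (isInvertible_chartDeriv he hq).bijective.surjective z
    rw [← mfderiv_comp_chart_apply he hq, h0]
    rfl

/-- Reduces the condition over all defining functions to the linear one. Any other defining function
vanishes along the coordinate segment through q in a direction killed by L, so its differential
kills that direction. -/
theorem mem_tangentLine_iff (he : e ∈ IsManifold.maximalAtlas (𝓡 2) ∞ S) {c : Set S}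
    {L : Plane →L[ℝ] ℝ} (hL : L ≠ 0) (hc : ∀ q ∈ e.source, q ∈ c ↔ L (e q) = 0) {q : S}
    (hq : q ∈ e.source) (hqc : q ∈ c) (v : TangentSpace (𝓡 2) q) :
    v ∈ tangentLine c q ↔ L (chartDeriv e q v) = 0 := by
  constructor
  · intro hv
    rw [← mfderiv_comp_chart_apply he hq]
    exact hv e.source _ hq (isDefiningFunctionOn_linear he hL hc)
  · intro hv U f hqU hf
    let w : Plane := chartDeriv e q v
    let γ : ℝ → Plane := fun t => e q + t • w
    have hγ : HasDerivAt γ w 0 := by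
      have h := ((hasDerivAt_id (0 : ℝ)).smul_const w).const_add (e q)
      rwa [one_smul] at h
    have hγ0 : γ 0 = e q := by simp [γ]
    have hfe : HasMFDerivAt (𝓡 2) 𝓘(ℝ, ℝ) (fun z => f (e.symm z)) (e q)
        ((mfderiv (𝓡 2) 𝓘(ℝ, ℝ) f (e.symm (e q))).comp
          (mfderiv (𝓡 2) (𝓡 2) e.symm (e q))) := by
      refine HasMFDerivAt.comp (e q) (MDifferentiableAt.hasMFDerivAt ?_)
        (MDifferentiableAt.hasMFDerivAt ?_)
      · rw [e.left_inv hq]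
        exact (hf.contMDiffOn.contMDiffAt (hf.isOpen.mem_nhds hqU)).mdifferentiableAt (by simp)
      · exact (mdifferentiable_of_mem_maximalAtlas he).mdifferentiableAt_symm (e.map_source hq)
    have hfe' := hasMFDerivAt_iff_hasFDerivAt.1 hfe
    rw [← hγ0] at hfe'
    have h1 := hfe'.comp_hasDerivAt (0 : ℝ) hγ
    have h2 : (fun z => f (e.symm z)) ∘ γ =ᶠ[𝓝 0] fun _ => 0 := by
      have h3 : ∀ᶠ t in 𝓝 (0 : ℝ), γ t ∈ e.target ∩ e.symm ⁻¹' U := by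
        refine hγ.continuousAt.eventually_mem
          ((e.isOpen_inter_preimage_symm hf.isOpen).mem_nhds ?_)
        rw [hγ0]
        exact ⟨e.map_source hq, by rwa [mem_preimage, e.left_inv hq]⟩
      filter_upwards [h3] with t ht
      refine (hf.mem_iff _ ht.2).1 ((hc _ (e.map_target ht.1)).2 ?_)
      rw [e.right_inv ht.1, map_add, map_smul, hv, (hc q hq).1 hqc]
      simp
    have h4 := h1.unique ((hasDerivAt_const (0 : ℝ) (0 : ℝ)).congr_of_eventuallyEq h2)
    have h5 := (mdifferentiable_of_mem_maximalAtlas he).symm_comp_deriv hq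
    have h6 := congrArg (fun L => L v) h5
    have h7 : (mfderiv (𝓡 2) (𝓡 2) e.symm (e q)) w = v := h6
    have h8 : (mfderiv (𝓡 2) 𝓘(ℝ, ℝ) f (e.symm (e q)))
        ((mfderiv (𝓡 2) (𝓡 2) e.symm (e q)) w) = 0 := by
      rw [← hγ0]
      exact h4
    rw [h7] at h8
    rw [e.left_inv hq] at h8
    exact h8

/-- A smooth curve is not given near one of its points by the zero linear form. -/
theorem linear_ne_zero_of_isCurve {c : Set S} (hc : IsSmoothClosedCurve c) {L : Plane →L[ℝ] ℝ}
    (hcL : ∀ q ∈ e.source, q ∈ c ↔ L (e q) = 0) {p : S} (hp : p ∈ e.source) (hpc : p ∈ c) :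
    L ≠ 0 := by
  rintro rfl
  obtain ⟨U, f, hpU, hf⟩ := hc.2 p hpc
  refine hf.mfderiv_ne_zero p hpU hpc ?_
  -- For L = 0 the curve would fill the chart domain, so a defining function would vanish
  -- identically near p.
  have h1 : f =ᶠ[𝓝 p] fun _ => 0 := by
    filter_upwards [hf.isOpen.mem_nhds hpU, e.open_source.mem_nhds hp] with q hq hq'
    exact (hf.mem_iff q hq).1 ((hcL q hq').2 rfl)
  rw [h1.mfderiv_eq]
  exact mfderiv_const

theorem det_ne_zero_of_transverse (he : e ∈ IsManifold.maximalAtlas (𝓡 2) ∞ S) {c c' : Set S}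
    {a b a' b' : ℝ} (hL : linForm a b ≠ 0) (hL' : linForm a' b' ≠ 0)
    (hc : ∀ q ∈ e.source, q ∈ c ↔ linForm a b (e q) = 0)
    (hc' : ∀ q ∈ e.source, q ∈ c' ↔ linForm a' b' (e q) = 0) {p : S} (hp : p ∈ e.source)
    (hpc : p ∈ c) (hpc' : p ∈ c') (ht : tangentLine c p ⊔ tangentLine c' p = ⊤) :
    a * b' - a' * b ≠ 0 := by
  intro h0
  -- If the determinant vanished, the two tangent lines would lie in one kernel and could not span
  -- the plane.
  have hker : ∀ z, linForm a' b' z = 0 → linForm a b z = 0 := by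
    intro z hz
    rw [linForm_apply] at hz ⊢
    rcases coeff_ne_zero_of_linForm_ne_zero hL' with h | h
    · refine mul_left_cancel₀ h ?_
      linear_combination a * hz - z 1 * h0
    · refine mul_left_cancel₀ h ?_
      linear_combination b * hz + z 0 * h0
  refine hL (ContinuousLinearMap.ext fun z => ?_)
  obtain ⟨v, rfl⟩ := (isInvertible_chartDeriv he hp).bijective.surjective z
  have hv : v ∈ tangentLine c p ⊔ tangentLine c' p := by rw [ht]; trivial
  obtain ⟨u, hu, w, hw, rfl⟩ := Submodule.mem_sup.1 hv
  rw [map_add, map_add, (mem_tangentLine_iff he hL hc hp hpc u).1 hu,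
    hker _ ((mem_tangentLine_iff he hL' hc' hp hpc' w).1 hw)]
  simp

/-- A 2-form at a point is a multiple of the determinant in a chart. -/
theorem exists_twoForm_apply_eq (he : e ∈ IsManifold.maximalAtlas (𝓡 2) ∞ S) {q : S}
    (hq : q ∈ e.source) (η : (TangentSpace (𝓡 2) q) [⋀^Fin 2]→L[ℝ] ℝ) :
    ∃ κ : ℝ, ∀ v w : TangentSpace (𝓡 2) q,
      η ![v, w] = κ * planeDet (chartDeriv e q v) (chartDeriv e q w) := by
  obtain ⟨T, hT⟩ := isInvertible_chartDeriv he hq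
  let η' : Plane [⋀^Fin 2]→L[ℝ] ℝ :=
    η.compContinuousLinearMap (T.symm : Plane →L[ℝ] TangentSpace (𝓡 2) q)
  refine ⟨_, fun v w => Eq.trans ?_ (alternating_plane_apply η' (chartDeriv e q v) _)⟩
  rw [← hT]
  simp only [η', ContinuousAlternatingMap.compContinuousLinearMap_apply]
  congr 1
  funext i
  fin_cases i <;> simp

end Tangent

end StarLog

/-! ### The coefficient of a b-form in a star chart -/

namespace StarLog

open Set Filter Topology

namespace StarChart

variable {S : Type*} [TopologicalSpace S] [ChartedSpace Plane S] [IsManifold (𝓡 2) ∞ S]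
  {n : ℕ} {D : StarDivisor S n} {p : S}

/-- The linear form of the `i`-th curve, normalised to `x` and `y` for the first two curves. -/
noncomputable def form (χ : StarChart D p) (i : Fin n) : Plane →L[ℝ] ℝ :=
  linForm (if i = χ.α then 1 else if i = χ.β then 0 else χ.A i)
    (if i = χ.α then 0 else if i = χ.β then 1 else χ.B i)

/-- The indices of all curves through `p`. -/
noncomputable def through (χ : StarChart D p) : Finset (Fin n) := insert χ.α (insert χ.β χ.others)

/-- The product of the linear forms of the curves through `p`. -/
noncomputable def formProd (χ : StarChart D p) (z : Plane) : ℝ := ∏ i ∈ χ.through, χ.form i z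

theorem mem_others (χ : StarChart D p) {i : Fin n} :
    i ∈ χ.others ↔ p ∈ D.curve i ∧ i ≠ χ.α ∧ i ≠ χ.β := by
  simp [others]

theorem mem_through (χ : StarChart D p) {i : Fin n} : i ∈ χ.through ↔ p ∈ D.curve i := by
  simp only [through, Finset.mem_insert, mem_others]
  constructor
  · rintro (rfl | rfl | h)
    exacts [χ.α_mem, χ.β_mem, h.1]
  · tauto

theorem form_α (χ : StarChart D p) (z : Plane) : χ.form χ.α z = z 0 := by
  simp [form, linForm_apply]

theorem form_β (χ : StarChart D p) (z : Plane) : χ.form χ.β z = z 1 := by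
  simp [form, linForm_apply, χ.α_lt_β.ne']

theorem form_of_mem_others (χ : StarChart D p) {i : Fin n} (hi : i ∈ χ.others) (z : Plane) :
    χ.form i z = χ.A i * z 0 + χ.B i * z 1 := by
  obtain ⟨_, h1, h2⟩ := χ.mem_others.1 hi
  simp [form, linForm_apply, h1, h2]

theorem β_notMem_others (χ : StarChart D p) : χ.β ∉ χ.others := fun h => (χ.mem_others.1 h).2.2 rfl

theorem α_notMem_insert (χ : StarChart D p) : χ.α ∉ insert χ.β χ.others := by
  rw [Finset.mem_insert, not_or]
  exact ⟨χ.α_lt_β.ne, fun h => (χ.mem_others.1 h).2.1 rfl⟩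

theorem β_lt_of_mem_others (χ : StarChart D p) {i : Fin n} (hi : i ∈ χ.others) : χ.β < i := by
  obtain ⟨h0, h1, h2⟩ := χ.mem_others.1 hi
  exact lt_of_le_of_ne ((χ.smallest i h0).resolve_left h1) h2.symm

theorem degree_eq (χ : StarChart D p) : D.degree p = χ.others.card + 2 := by
  have h1 : {i | p ∈ D.curve i} = (χ.through : Set (Fin n)) := by
    ext i
    simp [χ.mem_through]
  rw [StarDivisor.degree, h1, Set.ncard_coe_finset, through,
    Finset.card_insert_of_notMem χ.α_notMem_insert, Finset.card_insert_of_notMem χ.β_notMem_others]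

theorem formProd_eq (χ : StarChart D p) (z : Plane) :
    χ.formProd z = z 0 * z 1 * ∏ i ∈ χ.others, (χ.A i * z 0 + χ.B i * z 1) := by
  rw [formProd, through, Finset.prod_insert χ.α_notMem_insert,
    Finset.prod_insert χ.β_notMem_others, form_α, form_β, ← mul_assoc]
  congr 1
  exact Finset.prod_congr rfl fun i hi => χ.form_of_mem_others hi z

theorem formProd_smul (χ : StarChart D p) (r : ℝ) (z : Plane) :
    χ.formProd (r • z) = r ^ (χ.others.card + 2) * χ.formProd z := by
  simp only [formProd_eq, PiLp.smul_apply, smul_eq_mul]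
  have h1 : ∏ i ∈ χ.others, (χ.A i * (r * z 0) + χ.B i * (r * z 1))
      = r ^ χ.others.card * ∏ i ∈ χ.others, (χ.A i * z 0 + χ.B i * z 1) := by
    rw [← Finset.prod_const, ← Finset.prod_mul_distrib]
    exact Finset.prod_congr rfl fun i _ => by ring
  rw [h1]
  ring

theorem mem_curve_iff_form (χ : StarChart D p) {i : Fin n} (hi : p ∈ D.curve i) :
    ∀ q ∈ χ.chart.source, q ∈ D.curve i ↔ χ.form i (χ.chart q) = 0 := by
  intro q hq
  by_cases h1 : i = χ.α
  · rw [h1, form_α]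
    exact χ.curve_α q hq
  by_cases h2 : i = χ.β
  · rw [h2, form_β]
    exact χ.curve_β q hq
  rw [χ.form_of_mem_others (χ.mem_others.2 ⟨hi, h1, h2⟩)]
  exact χ.curve_line i hi q hq

theorem form_ne_zero (χ : StarChart D p) {i : Fin n} (hi : p ∈ D.curve i) : χ.form i ≠ 0 :=
  linear_ne_zero_of_isCurve (D.isCurve i) (χ.mem_curve_iff_form hi) χ.mem_source hi

theorem det_form_ne_zero (χ : StarChart D p) {i j : Fin n} (hi : p ∈ D.curve i)
    (hj : p ∈ D.curve j) (hij : i ≠ j) :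
    (if i = χ.α then 1 else if i = χ.β then 0 else χ.A i)
        * (if j = χ.α then 0 else if j = χ.β then 1 else χ.B j)
      - (if j = χ.α then 1 else if j = χ.β then 0 else χ.A j)
        * (if i = χ.α then 0 else if i = χ.β then 1 else χ.B i) ≠ 0 :=
  det_ne_zero_of_transverse χ.mem_atlas (χ.form_ne_zero hi) (χ.form_ne_zero hj)
    (χ.mem_curve_iff_form hi) (χ.mem_curve_iff_form hj) χ.mem_source hi hj
    (D.transverse i j hij p hi hj)

theorem coeff_ne_zero (χ : StarChart D p) {i : Fin n} (hi : i ∈ χ.others) :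
    χ.A i ≠ 0 ∧ χ.B i ≠ 0 := by
  obtain ⟨h0, h1, h2⟩ := χ.mem_others.1 hi
  have h3 := χ.det_form_ne_zero h0 χ.α_mem h1
  have h4 := χ.det_form_ne_zero h0 χ.β_mem h2
  simp [h1, h2, χ.α_lt_β.ne'] at h3 h4
  exact ⟨h4, h3⟩

theorem det_coeff_ne_zero (χ : StarChart D p) {i j : Fin n} (hi : i ∈ χ.others)
    (hj : j ∈ χ.others) (hij : i ≠ j) : χ.A i * χ.B j - χ.A j * χ.B i ≠ 0 := by
  obtain ⟨h0, h1, h2⟩ := χ.mem_others.1 hi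
  obtain ⟨h0', h1', h2'⟩ := χ.mem_others.1 hj
  have h3 := χ.det_form_ne_zero h0 h0' hij
  rwa [if_neg h1, if_neg h2, if_neg h1', if_neg h2', if_neg h1, if_neg h2, if_neg h1',
    if_neg h2'] at h3

/-- The part of the chart domain that misses the curves not passing through `p`. -/
def domain (χ : StarChart D p) : Set S :=
  χ.chart.source ∩ {q | ∀ i, q ∈ D.curve i → p ∈ D.curve i}

theorem isOpen_domain (χ : StarChart D p) : IsOpen χ.domain := by
  refine χ.chart.open_source.inter ?_
  have h1 : {q | ∀ i, q ∈ D.curve i → p ∈ D.curve i} = ⋂ i, {q | q ∈ D.curve i → p ∈ D.curve i} := by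
    ext q
    simp
  rw [h1]
  refine isOpen_iInter_of_finite fun i => ?_
  by_cases hi : p ∈ D.curve i
  · simp [hi]
  · simp only [hi, imp_false]
    exact (D.isCurve i).1.isOpen_compl

theorem mem_domain (χ : StarChart D p) : p ∈ χ.domain := ⟨χ.mem_source, fun _ h => h⟩

theorem mem_support_iff (χ : StarChart D p) {q : S} (hq : q ∈ χ.domain) :
    q ∈ D.support ↔ χ.formProd (χ.chart q) = 0 := by
  rw [formProd, Finset.prod_eq_zero_iff, StarDivisor.support, mem_iUnion]
  constructor
  · rintro ⟨i, hi⟩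
    exact ⟨i, χ.mem_through.2 (hq.2 i hi), (χ.mem_curve_iff_form (hq.2 i hi) q hq.1).1 hi⟩
  · rintro ⟨i, hi, h⟩
    exact ⟨i, (χ.mem_curve_iff_form (χ.mem_through.1 hi) q hq.1).2 h⟩

/-- A vector field whose coordinate expression is tangent to the lines is a `b`-vector field. -/
theorem isBVectorFieldOn_chartField (χ : StarChart D p) {V : Plane → Plane} (hV : ContDiff ℝ ∞ V)
    (ht : ∀ i ∈ χ.through, ∀ z, χ.form i z = 0 → χ.form i (V z) = 0) :
    IsBVectorFieldOn D χ.domain (chartField χ.chart V) where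
  contMDiffOn := (contMDiffOn_chartField χ.mem_atlas hV).mono inter_subset_left
  tangent := by
    intro q hq i hi
    have hpi := hq.2 i hi
    have hc := χ.mem_curve_iff_form hpi
    rw [mem_tangentLine_iff χ.mem_atlas (χ.form_ne_zero hpi) hc hq.1 hi,
      chartDeriv_chartField χ.mem_atlas hq.1]
    exact ht i (χ.mem_through.2 hpi) _ ((hc q hq.1).1 hi)

/-- The coordinate expression of the `b`-field `y ∏ (A i x + B i y) ∂_y`. -/
noncomputable def verticalField (χ : StarChart D p) (z : Plane) : Plane :=
  (z 1 * ∏ i ∈ χ.others, (χ.A i * z 0 + χ.B i * z 1)) • EuclideanSpace.single 1 1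

theorem contDiff_verticalField (χ : StarChart D p) : ContDiff ℝ ∞ χ.verticalField := by
  refine ContDiff.smul ((contDiff_coord 1).mul (contDiff_prod fun i _ => ?_)) contDiff_const
  exact (contDiff_const.mul (contDiff_coord 0)).add (contDiff_const.mul (contDiff_coord 1))

theorem planeDet_verticalField (χ : StarChart D p) (z : Plane) :
    planeDet z (χ.verticalField z) = χ.formProd z := by
  simp [planeDet, verticalField, formProd_eq]
  ring

theorem isBVectorFieldOn_euler (χ : StarChart D p) :
    IsBVectorFieldOn D χ.domain (chartField χ.chart id) :=
  χ.isBVectorFieldOn_chartField contDiff_id fun _ _ _ h => h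

/-- The coefficient vanishes on every line through p except {x = 0}, to which ∂_y is tangent. -/
theorem isBVectorFieldOn_vertical (χ : StarChart D p) :
    IsBVectorFieldOn D χ.domain (chartField χ.chart χ.verticalField) := by
  refine χ.isBVectorFieldOn_chartField χ.contDiff_verticalField fun i hi z hz => ?_
  rw [verticalField, map_smul, smul_eq_mul]
  simp only [through, Finset.mem_insert] at hi
  rcases hi with rfl | rfl | hi
  · simp [form_α]
  · rw [form_β] at hz
    simp [hz]
  · rw [χ.form_of_mem_others hi] at hz
    rw [Finset.prod_eq_zero hi hz]
    simp

/-- A `b`-form is `g / ∏ L_i` times the coordinate area form, with `g` smooth. -/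
theorem exists_coefficient (χ : StarChart D p) {Ω : TwoForm S} (hΩ : IsBTwoForm D Ω) :
    ∃ g : S → ℝ, ContMDiffOn (𝓡 2) 𝓘(ℝ, ℝ) ∞ g χ.domain ∧
      ∀ q ∈ χ.domain, q ∉ D.support → ∀ v w : TangentSpace (𝓡 2) q,
        Ω q ![v, w] = g q / χ.formProd (χ.chart q)
          * planeDet (chartDeriv χ.chart q v) (chartDeriv χ.chart q w) := by
  -- The determinant of these two b-fields is exactly `formProd`, so their pairing with Ω is the
  -- numerator.
  obtain ⟨g, hg, hgΩ⟩ := hΩ χ.domain χ.isOpen_domain _ _ χ.isBVectorFieldOn_euler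
    χ.isBVectorFieldOn_vertical
  refine ⟨g, hg, fun q hq hqD v w => ?_⟩
  obtain ⟨κ, hκ⟩ := exists_twoForm_apply_eq χ.mem_atlas hq.1 (Ω q)
  have h0 : χ.formProd (χ.chart q) ≠ 0 := fun h => hqD ((χ.mem_support_iff hq).2 h)
  have h1 := hgΩ q hq hqD
  rw [hκ, chartDeriv_chartField χ.mem_atlas hq.1, chartDeriv_chartField χ.mem_atlas hq.1, id,
    planeDet_verticalField] at h1
  rw [hκ, ← h1, mul_div_cancel_right₀ _ h0]

theorem exists_formProd_ne_zero (χ : StarChart D p) : ∃ v : Plane, χ.formProd v ≠ 0 := by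
  -- A direction (1, s) whose slope avoids those of the finitely many lines.
  obtain ⟨s, hs⟩ := Infinite.exists_notMem_finset
    (insert (0 : ℝ) (χ.others.image fun i => -χ.A i / χ.B i))
  rw [Finset.mem_insert, not_or] at hs
  refine ⟨!₂[1, s], ?_⟩
  rw [formProd_eq]
  refine mul_ne_zero (mul_ne_zero (by simp) (by simpa using hs.1))
    (Finset.prod_ne_zero_iff.2 fun i hi h => hs.2 (Finset.mem_image.2 ⟨i, hi, ?_⟩))
  have hB := (χ.coeff_ne_zero hi).2
  simp at h
  field_simp
  linear_combination -h

/-- The determinant of two `b`-fields is divisible by the product of the linear forms. -/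
theorem exists_planeDet_eq (χ : StarChart D p) {U : Set S} (hU : IsOpen U) (hpU : p ∈ U)
    {X Y : ∀ q : S, TangentSpace (𝓡 2) q} (hX : IsBVectorFieldOn D U X)
    (hY : IsBVectorFieldOn D U Y) :
    ∃ d : Plane → ℝ, ContDiff ℝ ∞ d ∧ ∀ᶠ z in 𝓝 (0 : Plane),
      planeDet (chartDeriv χ.chart (χ.chart.symm z) (X (χ.chart.symm z)))
        (chartDeriv χ.chart (χ.chart.symm z) (Y (χ.chart.symm z))) = χ.formProd z * d z := by
  set e := χ.chart with he
  set O := e.target ∩ e.symm ⁻¹' U with hOdef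
  have hO : IsOpen O := e.isOpen_inter_preimage_symm hU
  have hp0 : e.symm 0 = p := by rw [← χ.centered, e.left_inv χ.mem_source]
  have h0O : (0 : Plane) ∈ O :=
    ⟨χ.centered ▸ e.map_source χ.mem_source, by rwa [mem_preimage, hp0]⟩
  have hVX := contDiffOn_chartDeriv χ.mem_atlas hU hX.contMDiffOn
  have hVY := contDiffOn_chartDeriv χ.mem_atlas hU hY.contMDiffOn
  -- Division by the lines needs a function on the whole plane; the cutoff keeps the vanishing on
  -- the lines and changes nothing near 0.
  obtain ⟨b, hb, hbO, hb1⟩ := exists_contDiff_cutoff hO h0O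
  have hdet : ContDiffOn ℝ ∞ (fun z => planeDet (chartDeriv e (e.symm z) (X (e.symm z)))
      (chartDeriv e (e.symm z) (Y (e.symm z)))) O := by
    have hc : ∀ (i : Fin 2) {V : Plane → Plane}, ContDiffOn ℝ ∞ V O →
        ContDiffOn ℝ ∞ (fun z => V z i) O := fun i V hV => (contDiff_coord i).comp_contDiffOn hV
    exact ((hc 0 hVX).mul (hc 1 hVY)).sub ((hc 0 hVY).mul (hc 1 hVX))
  have hf := contDiff_mul_of_tsupport_subset hO hb hbO hdet
  obtain ⟨d, hd, hfd⟩ := exists_contDiff_eq_prod_mul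
    (fun i => if i = χ.α then 1 else if i = χ.β then 0 else χ.A i)
    (fun i => if i = χ.α then 0 else if i = χ.β then 1 else χ.B i) hf χ.through
    (fun i hi => χ.form_ne_zero (χ.mem_through.1 hi))
    (fun i hi j hj hij => χ.det_form_ne_zero (χ.mem_through.1 hi) (χ.mem_through.1 hj) hij) (by
      intro i hi z hz
      by_cases hzO : z ∈ O
      · have hpi := χ.mem_through.1 hi
        have hc := χ.mem_curve_iff_form hpi
        have hq : e.symm z ∈ e.source := e.map_target hzO.1
        have hqc : e.symm z ∈ D.curve i := (hc _ hq).2 (by rw [← he, e.right_inv hzO.1]; exact hz)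
        rw [planeDet_eq_zero_of_linForm (χ.form_ne_zero hpi), mul_zero]
        · exact (mem_tangentLine_iff χ.mem_atlas (χ.form_ne_zero hpi) hc hq hqc _).1
            (hX.tangent _ hzO.2 i hqc)
        · exact (mem_tangentLine_iff χ.mem_atlas (χ.form_ne_zero hpi) hc hq hqc _).1
            (hY.tangent _ hzO.2 i hqc)
      · rw [image_eq_zero_of_notMem_tsupport fun h => hzO (hbO h), zero_mul])
  refine ⟨d, hd, ?_⟩
  filter_upwards [hb1] with z hz
  have h1 := hfd z
  rw [hz, one_mul] at h1
  exact h1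

/-- The coefficient of a star log symplectic form does not vanish at `p`. -/
theorem coefficient_ne_zero (χ : StarChart D p) {Ω : TwoForm S} (hΩ : IsStarLogSymplectic D Ω)
    {g : S → ℝ} (hg : ContMDiffOn (𝓡 2) 𝓘(ℝ, ℝ) ∞ g χ.domain)
    (hgΩ : ∀ q ∈ χ.domain, q ∉ D.support → ∀ v w : TangentSpace (𝓡 2) q,
        Ω q ![v, w] = g q / χ.formProd (χ.chart q)
          * planeDet (chartDeriv χ.chart q v) (chartDeriv χ.chart q w)) : g p ≠ 0 := by
  intro hgp
  obtain ⟨U, X, Y, g', hU, hpU, hX, hY, ⟨hg', hg'Ω⟩, hg'p⟩ := hΩ.nondegenerate p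
  obtain ⟨d, hd, hXY⟩ := χ.exists_planeDet_eq hU hpU hX hY
  -- The identity Ω(X, Y) = g d holds only off the divisor. It passes to p as a limit along the ray
  -- of v, which misses the divisor near p except at p.
  obtain ⟨v, hv⟩ := χ.exists_formProd_ne_zero
  have hp0 : χ.chart.symm 0 = p := by rw [← χ.centered, χ.chart.left_inv χ.mem_source]
  have h0t : (0 : Plane) ∈ χ.chart.target := χ.centered ▸ χ.chart.map_source χ.mem_source
  have hγ : Tendsto (fun t : ℝ => t • v) (𝓝[≠] 0) (𝓝 0) := by
    have hc : Continuous fun t : ℝ => t • v := by fun_prop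
    simpa using (hc.tendsto 0).mono_left (nhdsWithin_le_nhds (s := {0}ᶜ))
  have hs : Tendsto χ.chart.symm (𝓝 0) (𝓝 p) := by
    have := (χ.chart.continuousAt_symm h0t).tendsto
    rwa [hp0] at this
  have hlim : Tendsto (fun t : ℝ => g' (χ.chart.symm (t • v))) (𝓝[≠] 0) (𝓝 (g' p)) :=
    ((hg'.continuousOn.continuousAt (hU.mem_nhds hpU)).tendsto.comp hs).comp hγ
  have hlim' : Tendsto (fun t : ℝ => g (χ.chart.symm (t • v)) * d (t • v)) (𝓝[≠] 0)
      (𝓝 (g p * d 0)) :=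
    (((hg.continuousOn.continuousAt (χ.isOpen_domain.mem_nhds χ.mem_domain)).tendsto.comp
      hs).comp hγ).mul ((hd.continuous.tendsto 0).comp hγ)
  refine hg'p ?_
  rw [tendsto_nhds_unique hlim (hlim'.congr' ?_), hgp, zero_mul]
  filter_upwards [self_mem_nhdsWithin, hγ.eventually hXY, hγ (χ.chart.open_target.mem_nhds h0t),
    (hs.comp hγ) (hU.mem_nhds hpU), (hs.comp hγ) (χ.isOpen_domain.mem_nhds χ.mem_domain)]
    with t ht h1 h2 h3 h4
  have h5 : χ.formProd (t • v) ≠ 0 := by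
    rw [formProd_smul]
    exact mul_ne_zero (pow_ne_zero _ ht) hv
  have h2' : t • v ∈ χ.chart.target := h2
  have h3' : χ.chart.symm (t • v) ∈ U := h3
  have h4' : χ.chart.symm (t • v) ∈ χ.domain := h4
  have h6 : χ.chart.symm (t • v) ∉ D.support := by
    rw [χ.mem_support_iff h4', χ.chart.right_inv h2']
    exact h5
  rw [← hg'Ω _ h3' h6, hgΩ _ h4' h6, h1, χ.chart.right_inv h2']
  field_simp

end StarChart

end StarLog

/-! ### The radial diffeomorphism and the normal form -/

namespace StarLog

open Set Filter Topology

theorem exists_root_normalization {a : ℝ} (ha : a ≠ 0) {m : ℕ} (hm : m ≠ 0) :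
    ∃ r : ℝ, r ≠ 0 ∧ (a / r ^ m = 1 ∨ a / r ^ m = -1) ∧ (Odd m → a / r ^ m = 1) := by
  have hs : (|a| ^ (m⁻¹ : ℝ)) ^ m = |a| := Real.rpow_inv_natCast_pow (abs_nonneg a) hm
  have hs0 : |a| ^ (m⁻¹ : ℝ) ≠ 0 := (Real.rpow_pos_of_pos (abs_pos.2 ha) _).ne'
  rcases lt_or_gt_of_ne ha with h | h
  · rw [abs_of_neg h] at hs hs0
    by_cases hodd : Odd m
    · refine ⟨-((-a) ^ (m⁻¹ : ℝ)), neg_ne_zero.2 hs0, ?_⟩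
      rw [hodd.neg_pow, hs, neg_neg, div_self ha]
      simp
    · refine ⟨_, hs0, Or.inr ?_, fun h => absurd h hodd⟩
      rw [hs, div_neg, div_self ha]
  · rw [abs_of_pos h] at hs hs0
    refine ⟨_, hs0, ?_⟩
    rw [hs, div_self ha]
    simp

section RadialMap

variable {ρ : Plane → ℝ} {O : Set Plane}

theorem hasFDerivAt_radialMap (hO : IsOpen O) (hρ : ContDiffOn ℝ ∞ ρ O) {z : Plane} (hz : z ∈ O) :
    HasFDerivAt (fun z => ρ z • z)
      (ρ z • ContinuousLinearMap.id ℝ Plane + (fderiv ℝ ρ z).smulRight z) z :=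
  ((hρ.contDiffAt (hO.mem_nhds hz)).differentiableAt (by simp)).hasFDerivAt.smul (hasFDerivAt_id z)

/-- The rank one perturbation r·id + L ⊗ z has determinant r (r + L z). -/
theorem planeDet_radialMap (r : ℝ) (L : Plane →L[ℝ] ℝ) (z v w : Plane) :
    planeDet (r • v + L v • z) (r • w + L w • z) = r * (r + L z) * planeDet v w := by
  have h : ∀ u : Plane, L u = u 0 * L (EuclideanSpace.single 0 1)
      + u 1 * L (EuclideanSpace.single 1 1) := by
    intro u
    conv_lhs => rw [eq_coord_smul_add u]
    simp
  rw [h v, h w, h z]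
  simp only [planeDet, PiLp.add_apply, PiLp.smul_apply, smul_eq_mul]
  ring

/-- The radial map `z ↦ ρ z • z` is a local diffeomorphism where its Jacobian does not vanish. -/
theorem exists_openPartialHomeomorph_radialMap (hO : IsOpen O) (hρ : ContDiffOn ℝ ∞ ρ O)
    (h0 : (0 : Plane) ∈ O) (hne : ∀ z ∈ O, ρ z ≠ 0) {B : Set Plane} (hB : IsOpen B)
    (h0B : (0 : Plane) ∈ B) :
    ∃ ψ : OpenPartialHomeomorph Plane Plane, 0 ∈ ψ.source ∧ ψ.source ⊆ O ∩ B ∧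
      ψ.target ⊆ B ∧ (∀ z, ψ z = ρ z • z) ∧ ContDiffOn ℝ ∞ ψ ψ.source ∧
      ContDiffOn ℝ ∞ ψ.symm ψ.target := by
  have hψ : ContDiffOn ℝ ∞ (fun z => ρ z • z) O := hρ.smul contDiffOn_id
  have hc1 : ContinuousOn (fun z => ρ z + fderiv ℝ ρ z z) O :=
    hρ.continuousOn.add
      ((hρ.continuousOn_fderiv_of_isOpen hO (by simp)).clm_apply continuousOn_id)
  -- The Jacobian is ρ (ρ + Eρ), so only the second factor has to be kept away from 0; at the origin
  -- it equals ρ(0).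
  set O₁ := O ∩ (fun z => ρ z + fderiv ℝ ρ z z) ⁻¹' {0}ᶜ
  have hO₁ : IsOpen O₁ := hc1.isOpen_inter_preimage hO isOpen_compl_singleton
  set O₂ := O ∩ (fun z => ρ z • z) ⁻¹' B
  have hO₂ : IsOpen O₂ := hψ.continuousOn.isOpen_inter_preimage hO hB
  obtain ⟨ψ, h0ψ, hψs, hψe, hψi⟩ := exists_openPartialHomeomorph_of_contDiffOn
    (f := fun z => ρ z • z) (O := O₁ ∩ O₂ ∩ B) ((hO₁.inter hO₂).inter hB)
    (hψ.mono fun z hz => hz.1.1.1) (a := 0)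
    ⟨⟨⟨h0, by simpa using hne 0 h0⟩, ⟨h0, by simpa using h0B⟩⟩, h0B⟩ (by
      intro z hz
      have hd := hasFDerivAt_radialMap hO hρ hz.1.1.1
      have hz1 : ρ z + fderiv ℝ ρ z z ≠ 0 := hz.1.1.2
      have hρz := hne z hz.1.1.1
      let T : Plane →L[ℝ] Plane :=
        ρ z • ContinuousLinearMap.id ℝ Plane + (fderiv ℝ ρ z).smulRight z
      have hT : Function.Injective (T : Plane →ₗ[ℝ] Plane) := by
        rw [injective_iff_map_eq_zero]
        intro v hv
        have hv' : ρ z • v + fderiv ℝ ρ z v • z = 0 := hv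
        -- Applying dρ to the kernel equation kills dρ(v), and then ρ v = 0.
        have h1 : (ρ z + fderiv ℝ ρ z z) * fderiv ℝ ρ z v = 0 := by
          have := congrArg (fderiv ℝ ρ z) hv'
          simp only [map_add, map_smul, smul_eq_mul, map_zero] at this
          linear_combination this
        rw [(mul_eq_zero.1 h1).resolve_left hz1, zero_smul, add_zero] at hv'
        exact (smul_eq_zero.1 hv').resolve_left hρz
      refine ⟨(LinearEquiv.ofInjectiveEndo _ hT).toContinuousLinearEquiv, ?_⟩
      refine hd.congr_fderiv ?_
      ext v
      rfl)
  refine ⟨ψ, h0ψ, fun z hz => ⟨(hψs hz).1.1.1, (hψs hz).2⟩, fun w hw => ?_, hψe, ?_, hψi⟩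
  · have h1 : ρ (ψ.symm w) • ψ.symm w ∈ B := (hψs (ψ.map_target hw)).1.2.2
    rwa [← hψe, ψ.right_inv hw] at h1
  · exact (hψ.mono fun z hz => (hψs hz).1.1.1).congr fun z _ => hψe z

end RadialMap

namespace StarChart

variable {S : Type*} [TopologicalSpace S] [ChartedSpace Plane S] [IsManifold (𝓡 2) ∞ S]
  {n : ℕ} {D : StarDivisor S n} {p : S}

theorem dxdy_apply (χ : StarChart D p) {q : S} (hq : q ∈ χ.chart.source)
    (v : Fin 2 → TangentSpace (𝓡 2) q) :
    χ.dxdy q v = planeDet (chartDeriv χ.chart q (v 0)) (chartDeriv χ.chart q (v 1)) := by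
  have h : ∀ (i : Fin 2) (u : TangentSpace (𝓡 2) q),
      mfderiv (𝓡 2) 𝓘(ℝ, ℝ) (fun q => χ.chart q i) q u = chartDeriv χ.chart q u i := fun i u =>
    mfderiv_comp_chart_apply χ.mem_atlas hq (EuclideanSpace.proj (𝕜 := ℝ) i : Plane →L[ℝ] ℝ) u
  exact congrArg₂ (fun a b : ℝ => a - b) (congrArg₂ (fun a b : ℝ => a * b) (h 0 (v 0)) (h 1 (v 1)))
    (congrArg₂ (fun a b : ℝ => a * b) (h 0 (v 1)) (h 1 (v 0)))

/-- The coordinate expression of a star log symplectic form near `p`. -/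
theorem exists_local_form (χ : StarChart D p) {Ω : TwoForm S} (hΩ : IsStarLogSymplectic D Ω) :
    ∃ (F : Plane → ℝ) (B : Set Plane), ContDiff ℝ ∞ F ∧ F 0 ≠ 0 ∧ IsOpen B ∧ 0 ∈ B ∧
      (∀ z ∈ B, z ∈ χ.chart.target ∧ χ.chart.symm z ∈ χ.domain) ∧
      ∀ q ∈ χ.chart.source, χ.chart q ∈ B → q ∉ D.support → ∀ v w : TangentSpace (𝓡 2) q,
        Ω q ![v, w] = F (χ.chart q) / χ.formProd (χ.chart q)
          * planeDet (chartDeriv χ.chart q v) (chartDeriv χ.chart q w) := by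
  obtain ⟨g, hg, hgΩ⟩ := χ.exists_coefficient hΩ.isBTwoForm
  have hgp := χ.coefficient_ne_zero hΩ hg hgΩ
  have hp0 : χ.chart.symm 0 = p := by rw [← χ.centered, χ.chart.left_inv χ.mem_source]
  have h0t : (0 : Plane) ∈ χ.chart.target := χ.centered ▸ χ.chart.map_source χ.mem_source
  set O := χ.chart.target ∩ χ.chart.symm ⁻¹' χ.domain
  have hO : IsOpen O := χ.chart.isOpen_inter_preimage_symm χ.isOpen_domain
  have h0O : (0 : Plane) ∈ O := ⟨h0t, by rw [mem_preimage, hp0]; exact χ.mem_domain⟩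
  have hgs : ContDiffOn ℝ ∞ (fun z => g (χ.chart.symm z)) O :=
    contMDiffOn_iff_contDiffOn.1 (hg.comp
      ((contMDiffOn_symm_of_mem_maximalAtlas χ.mem_atlas).mono inter_subset_left)
      fun z hz => hz.2)
  obtain ⟨F, hF, hFg⟩ := exists_contDiff_eventuallyEq hO h0O hgs
  obtain ⟨B, hBF, hB, h0B⟩ := mem_nhds_iff.1 (inter_mem (hO.mem_nhds h0O) hFg)
  refine ⟨F, B, hF, ?_, hB, h0B, fun z hz => (hBF hz).1, fun q hq hqB hqD v w => ?_⟩
  · have h1 : F 0 = g (χ.chart.symm 0) := (hBF h0B).2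
    rw [h1, hp0]
    exact hgp
  · have h1 := (hBF hqB).1.2
    have h2 : F (χ.chart q) = g (χ.chart.symm (χ.chart q)) := (hBF hqB).2
    rw [mem_preimage, χ.chart.left_inv hq] at h1
    rw [χ.chart.left_inv hq] at h2
    rw [h2]
    exact hgΩ q h1 hqD v w

/-- The normal form in coordinates, from a constant plus a homogeneous polynomial. -/
theorem exists_normalForm_coefficients (χ : StarChart D p) {F h ρ : Plane → ℝ} {c : ℝ}
    (hF : F 0 ≠ 0) (hh : IsHomogeneousPoly χ.others.card h) (hρ : ρ 0 ≠ 0)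
    (hc0 : χ.others.card = 0 → c = 0) (hc : χ.others.card ≠ 0 → c ≠ 0)
    (heq : (ρ 0 + fderiv ℝ ρ 0 0) * F (ρ 0 • 0) = (c + h 0) * ρ 0 ^ (χ.others.card + 1)) :
    ∃ (c' : ℝ) (lam del : Fin n → ℝ) (nu : Fin n → Fin n → ℝ), c' ≠ 0 ∧
      (χ.others.card ≠ 0 → c' = c) ∧ ∀ q, χ.formProd (χ.chart q) ≠ 0 →
        c' / (χ.x q * χ.y q * ∏ i ∈ χ.others, χ.line i q) + χ.polePart lam del nu q
          = (c + h (χ.chart q)) / χ.formProd (χ.chart q) := by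
  by_cases hm : χ.others.card = 0
  · rw [hm] at hh heq
    obtain ⟨a, ha⟩ := hh
    -- With k = 2 the radial identity at the origin reads ρ(0) F(0) = h(0) ρ(0): the constant is an
    -- invariant and cannot be rescaled.
    have ha0 : a = F 0 := by
      simp [ha, hc0 hm] at heq
      exact (mul_left_cancel₀ hρ (heq.trans (mul_comm _ _))).symm
    refine ⟨a, 0, 0, 0, ha0 ▸ hF, fun h => absurd hm h, fun q _ => ?_⟩
    rw [formProd_eq]
    simp [polePart, ha, hc0 hm, Finset.card_eq_zero.1 hm, x, y]
  · obtain ⟨lam, del, nu, hlam⟩ := exists_partialFractions_coord χ.α_lt_β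
      (fun i hi => χ.β_lt_of_mem_others hi) χ.A χ.B (fun i hi => χ.coeff_ne_zero hi)
      (fun i hi j hj hij => χ.det_coeff_ne_zero hi hj hij)
      (Finset.card_ne_zero.1 hm) hh
    refine ⟨c, lam, del, nu, hc hm, fun _ => rfl, fun q hq => ?_⟩
    rw [formProd_eq] at hq ⊢
    have h1 := left_ne_zero_of_mul hq
    have h2 := hlam (χ.chart q) (left_ne_zero_of_mul h1) (right_ne_zero_of_mul h1)
      (Finset.prod_ne_zero_iff.1 (right_ne_zero_of_mul hq))
    rw [add_div, h2]
    rfl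

/-- A radial local diffeomorphism in a star chart respects the divisor and pulls the form back
according to its Jacobian. -/
theorem isBSymplectomorphism_radial (χ : StarChart D p) {Ω Ω₀ : TwoForm S} {F f ρ : Plane → ℝ}
    {O B : Set Plane} (hO : IsOpen O) (hρ : ContDiffOn ℝ ∞ ρ O) (hne : ∀ z ∈ O, ρ z ≠ 0)
    (hBt : ∀ z ∈ B, z ∈ χ.chart.target ∧ χ.chart.symm z ∈ χ.domain)
    (hΩ : ∀ q ∈ χ.chart.source, χ.chart q ∈ B → q ∉ D.support → ∀ v w : TangentSpace (𝓡 2) q,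
        Ω q ![v, w] = F (χ.chart q) / χ.formProd (χ.chart q)
          * planeDet (chartDeriv χ.chart q v) (chartDeriv χ.chart q w))
    (hΩ₀ : ∀ q ∈ χ.chart.source, q ∉ D.support → χ.formProd (χ.chart q) ≠ 0 →
      ∀ v : Fin 2 → TangentSpace (𝓡 2) q, Ω₀ q v = f (χ.chart q) / χ.formProd (χ.chart q)
          * planeDet (chartDeriv χ.chart q (v 0)) (chartDeriv χ.chart q (v 1)))
    (heq : ∀ z ∈ O, (ρ z + fderiv ℝ ρ z z) * F (ρ z • z) = f z * ρ z ^ (χ.others.card + 1))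
    {ψ : OpenPartialHomeomorph Plane Plane} (hψs : ψ.source ⊆ O ∩ B) (hψt : ψ.target ⊆ B)
    (hψ : ∀ z, ψ z = ρ z • z) (hψ1 : ContDiffOn ℝ ∞ ψ ψ.source)
    (hψ2 : ContDiffOn ℝ ∞ ψ.symm ψ.target) :
    IsBSymplectomorphism D Ω₀ Ω ((χ.chart.trans ψ).trans χ.chart.symm) := by
  set e := χ.chart with he
  set Ψ := (e.trans ψ).trans e.symm with hΨ
  have hΨs : ∀ q ∈ Ψ.source, q ∈ e.source ∧ e q ∈ ψ.source := by
    intro q hq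
    simp only [hΨ, OpenPartialHomeomorph.trans_source] at hq
    exact ⟨hq.1.1, hq.1.2⟩
  have hΨt : ∀ q ∈ Ψ.target, q ∈ e.source ∧ e q ∈ ψ.target := by
    intro q hq
    simp only [hΨ, OpenPartialHomeomorph.trans_target] at hq
    exact ⟨hq.1, hq.2.1⟩
  have hΨB : ∀ q ∈ Ψ.source, ψ (e q) ∈ B := fun q hq => hψt (ψ.map_source (hΨs q hq).2)
  have heΨ : ∀ q ∈ Ψ.source, e (Ψ q) = ψ (e q) := fun q hq =>
    e.right_inv (hBt _ (hΨB q hq)).1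
  have hsm := contMDiffOn_of_mem_maximalAtlas χ.mem_atlas
  have hsm' := contMDiffOn_symm_of_mem_maximalAtlas χ.mem_atlas
  have hdom : ∀ q ∈ Ψ.source, q ∈ χ.domain := fun q hq => by
    have h1 := (hBt _ (hψs (hΨs q hq).2).2).2
    rwa [e.left_inv (hΨs q hq).1] at h1
  have hdom' : ∀ q ∈ Ψ.source, Ψ q ∈ χ.domain := fun q hq => (hBt _ (hΨB q hq)).2
  have hcurve : ∀ i, ∀ q ∈ Ψ.source, Ψ q ∈ D.curve i ↔ q ∈ D.curve i := by
    intro i q hq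
    by_cases hi : p ∈ D.curve i
    · rw [χ.mem_curve_iff_form hi _ (hdom' q hq).1, χ.mem_curve_iff_form hi _ (hdom q hq).1,
        ← he, heΨ q hq, hψ, map_smul, smul_eq_zero,
        or_iff_right (hne _ (hψs (hΨs q hq).2).1)]
    -- Curves that do not pass through p meet neither the source nor the image.
    · exact ⟨fun h => absurd ((hdom' q hq).2 i h) hi, fun h => absurd ((hdom q hq).2 i h) hi⟩
  have hc1 : ContMDiffOn (𝓡 2) (𝓡 2) ∞ Ψ Ψ.source :=
    hsm'.comp ((contMDiffOn_iff_contDiffOn.2 hψ1).comp (hsm.mono fun q hq => (hΨs q hq).1)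
      fun q hq => (hΨs q hq).2) fun q hq => (hBt _ (hΨB q hq)).1
  refine ⟨hc1, ?_, hcurve, ?_⟩
  · exact hsm'.comp ((contMDiffOn_iff_contDiffOn.2 hψ2).comp (hsm.mono fun q hq => (hΨt q hq).1)
      fun q hq => (hΨt q hq).2) fun q hq =>
        (hBt _ (hψs (ψ.map_target (hΨt q hq).2)).2).1
  · intro q hq hqD
    have hqe := (hΨs q hq).1
    have hzO : e q ∈ O := (hψs (hΨs q hq).2).1
    have hQ : χ.formProd (e q) ≠ 0 := fun h => hqD ((χ.mem_support_iff (hdom q hq)).2 h)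
    have hΨD : Ψ q ∉ D.support := by
      intro h
      obtain ⟨i, hi⟩ := mem_iUnion.1 h
      exact hqD (mem_iUnion.2 ⟨i, (hcurve i q hq).1 hi⟩)
    have hchain : ∀ v : TangentSpace (𝓡 2) q,
        chartDeriv e (Ψ q) (mfderiv (𝓡 2) (𝓡 2) Ψ q v)
          = ρ (e q) • chartDeriv e q v + fderiv ℝ ρ (e q) (chartDeriv e q v) • e q := by
      intro v
      have hd1 : HasMFDerivAt (𝓡 2) (𝓡 2) (e ∘ Ψ) q
          ((chartDeriv e (Ψ q)).comp (mfderiv (𝓡 2) (𝓡 2) Ψ q)) :=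
        (hasMFDerivAt_chart χ.mem_atlas (hdom' q hq).1).comp q
          ((hc1.contMDiffAt (Ψ.open_source.mem_nhds hq)).mdifferentiableAt (by simp)).hasMFDerivAt
      have hd2 : HasMFDerivAt (𝓡 2) (𝓡 2) ((fun z => ρ z • z) ∘ e) q
          ((ρ (e q) • ContinuousLinearMap.id ℝ Plane
            + (fderiv ℝ ρ (e q)).smulRight (e q)).comp (chartDeriv e q)) :=
        HasMFDerivAt.comp q (hasFDerivAt_radialMap hO hρ hzO).hasMFDerivAt
          (hasMFDerivAt_chart χ.mem_atlas hqe)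
      have hd3 : (e ∘ Ψ) =ᶠ[𝓝 q] ((fun z => ρ z • z) ∘ e) := by
        filter_upwards [Ψ.open_source.mem_nhds hq] with w hw
        exact (heΨ w hw).trans (hψ _)
      have hd4 := hasMFDerivAt_unique hd1 (hd2.congr_of_eventuallyEq hd3)
      exact congrArg (fun L => L v) hd4
    have hρz := hne _ hzO
    ext v
    have hv : (Ω (Ψ q)).compContinuousLinearMap (mfderiv (𝓡 2) (𝓡 2) Ψ q) v
        = Ω (Ψ q) ![mfderiv (𝓡 2) (𝓡 2) Ψ q (v 0), mfderiv (𝓡 2) (𝓡 2) Ψ q (v 1)] := by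
      rw [ContinuousAlternatingMap.compContinuousLinearMap_apply]
      congr 1
      funext i
      fin_cases i <;> rfl
    rw [hv, hΩ _ (hdom' q hq).1 (by rw [heΨ q hq]; exact hΨB q hq) hΨD, hchain, hchain,
      planeDet_radialMap, heΨ q hq, hψ, formProd_smul, hΩ₀ q hqe hqD hQ]
    -- The factor ρ (ρ + Eρ) comes from the Jacobian and ρ^(m+2) from the homogeneity of the
    -- denominator.
    have h1 := heq _ hzO
    rw [← mul_assoc]
    congr 1
    field_simp
    linear_combination ρ (e q) * h1

/-- Normal form of a star log symplectic form at an intersection point of the divisor. -/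
theorem exists_normalForm (χ : StarChart D p) {Ω : TwoForm S} (hΩ : IsStarLogSymplectic D Ω) :
    ∃ (c : ℝ) (lam del : Fin n → ℝ) (nu : Fin n → Fin n → ℝ) (Ψ : OpenPartialHomeomorph S S),
      c ≠ 0 ∧ (χ.others.card ≠ 0 → c = 1 ∨ c = -1) ∧ (Odd χ.others.card → c = 1) ∧
      p ∈ Ψ.source ∧ Ψ.source ⊆ χ.chart.source ∧ Ψ p = p ∧
      IsBSymplectomorphism D (χ.normalForm c lam del nu) Ω Ψ := by
  obtain ⟨F, B, hF, hF0, hB, h0B, hBt, hΩF⟩ := χ.exists_local_form hΩ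
  obtain ⟨r, hr, hr1, hr2⟩ : ∃ r : ℝ, r ≠ 0 ∧
      (χ.others.card ≠ 0 → F 0 / r ^ χ.others.card = 1 ∨ F 0 / r ^ χ.others.card = -1) ∧
      (Odd χ.others.card → F 0 / r ^ χ.others.card = 1) := by
    by_cases hm : χ.others.card = 0
    · exact ⟨1, one_ne_zero, fun h => absurd hm h, by simp [hm]⟩
    · obtain ⟨r, hr, h1, h2⟩ := exists_root_normalization hF0 hm
      exact ⟨r, hr, fun _ => h1, h2⟩
  obtain ⟨h, ρ, c₀, O, hh, hO, h0O, hρ, hρ0, hc0, hc1, heq⟩ :=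
    exists_radial_scaling hF hF0 χ.others.card hr
  obtain ⟨c, lam, del, nu, hc, hcc, hnf⟩ := χ.exists_normalForm_coefficients hF0 hh
    (hρ0 ▸ hr) hc0 (fun hm => by rw [hc1 hm]; exact div_ne_zero hF0 (pow_ne_zero _ hr))
    (heq 0 h0O).2
  obtain ⟨ψ, h0ψ, hψs, hψt, hψ, hψ1, hψ2⟩ := exists_openPartialHomeomorph_radialMap hO hρ h0O
    (fun z hz => (heq z hz).1) hB h0B
  have hψ0 : ψ 0 = 0 := by rw [hψ, smul_zero]
  have h0t : (0 : Plane) ∈ χ.chart.target := (hBt 0 h0B).1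
  refine ⟨c, lam, del, nu, (χ.chart.trans ψ).trans χ.chart.symm, hc, fun hm => ?_, fun hm => ?_,
    ?_, ?_, ?_, ?_⟩
  · rw [hcc hm, hc1 hm]
    exact hr1 hm
  · have hm' : χ.others.card ≠ 0 := hm.pos.ne'
    rw [hcc hm', hc1 hm']
    exact hr2 hm
  · simp [χ.mem_source, χ.centered, h0ψ, hψ0, h0t]
  · intro q hq
    simp only [OpenPartialHomeomorph.trans_source] at hq
    exact hq.1.1
  · change χ.chart.symm (ψ (χ.chart p)) = p
    rw [χ.centered, hψ0, ← χ.centered, χ.chart.left_inv χ.mem_source]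
  · refine χ.isBSymplectomorphism_radial (f := fun z => c₀ + h z) hO hρ
      (fun z hz => (heq z hz).1) hBt hΩF ?_ (fun z hz => (heq z hz).2) hψs hψt hψ hψ1 hψ2
    intro q hq _ hQ v
    rw [← hnf q hQ, ← χ.dxdy_apply hq]
    rfl

end StarChart

end StarLog

theorem proposition3p2 {S : Type*} [TopologicalSpace S] [ChartedSpace StarLog.Plane S]
    [IsManifold (𝓡 2) ∞ S] {n : ℕ} (D : StarLog.StarDivisor S n)
    (Ω : StarLog.TwoForm S) (hΩ : StarLog.IsStarLogSymplectic D Ω)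
    (p : S) (k : ℕ) (hk : D.degree p = k) (χ : StarLog.StarChart D p) :
    ∃ (c : ℝ) (lam del : Fin n → ℝ) (nu : Fin n → Fin n → ℝ) (Ψ : OpenPartialHomeomorph S S),
      c ≠ 0 ∧ (3 ≤ k → c = 1 ∨ c = -1) ∧ (3 ≤ k → Odd k → c = 1) ∧
      p ∈ Ψ.source ∧ Ψ.source ⊆ χ.chart.source ∧ Ψ p = p ∧
      StarLog.IsBSymplectomorphism D (χ.normalForm c lam del nu) Ω Ψ := by
  obtain ⟨c, lam, del, nu, Ψ, hc, h1, h2, h⟩ := χ.exists_normalForm hΩ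
  have hdeg := χ.degree_eq
  -- The number of remaining lines is k - 2, which has the parity of k.
  refine ⟨c, lam, del, nu, Ψ, hc, fun hk3 => h1 (by omega), fun _ hodd => h2 ?_, h⟩
  rw [Nat.odd_iff] at hodd ⊢
  omega
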